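/- **Notation.** Let $\mathbb D\subset\mathbb C$ be the open unit disc and let $\Phi\colon\mathbb D^n\to\mathbb C^{n+1}\setminus\{0\}$ be a holomorphic map. For $\zeta\in\mathbb C^{N}$ put $|\zeta|^2=\sum_j|\zeta_j|^2$, $\langle\zeta,\zeta\rangle=\sum_j\zeta_j^2$, $A(\zeta)=\tfrac12(|\zeta|^2+|\langle\zeta,\zeta\rangle|)$, $B(\zeta)=\tfrac12(|\zeta|^2-|\langle\zeta,\zeta\rangle|)$, and for $\varepsilon>0$ $$h_\varepsilon=\log\big((A+\varepsilon B)^{1/2}+(B+\varepsilon A)^{1/2}\big).$$ (If $\zeta=e^{i\theta}(a+ib)$ with $a,b\in\mathbb R^N$ orthogonal and $|b|\le|a|$, then $A(\zeta)=|a|^2$ and $B(\zeta)=|b|^2$, and $h_\varepsilon$ decreases to the logarithm $h$ of the Lie norm as $\varepsilon\searrow0$.) With $d^c=i(\bar\partial-\partial)$, the Monge–Ampère measure of a smooth function $u$ on an open subset of $\mathbb C^n$ is $(dd^cu)^n=4^n\,n!\,\det\big(\partial^2u/\partial z_j\partial\bar z_k\big)\,dV$, where $dV=\bigwedge_j\tfrac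 i2dz_j\wedge d\bar z_j$. Define $$\tilde\Phi\colon\mathbb D^{n+1}\to\mathbb C^{n+1},\qquad \tilde\Phi(z,z_{n+1})=(1+z_{n+1})\Phi(z),\qquad W=\{z\in\mathbb D^{n+1}:\det J_{\tilde\Phi}(z)\neq0\},$$ so that $\tilde\Phi$ is locally biholomorphic on $W$. The pullback of a current $T$ of top degree under $\tilde\Phi|_W$ is given by $\langle\tilde\Phi^*T,\chi\rangle=\langle T,\tilde\Phi_*\chi\rangle$, where $\tilde\Phi_*\chi(\zeta)=\sum_{w\in W,\ \tilde\Phi(w)=\zeta}\chi(w)$, for $\chi\in C_c^\infty(W)$. Let $\mathbb C\mathbb R^{n+1}=\{e^{i\theta}a:\theta\in\mathbb R,\ a\in\mathbb R^{n+1}\}$, $dV_a=da_1\wedge\dots\wedge da_{n+1}$, and $C_n=(-1)^{n(n-1)/2}\,n!\,\Omega_n$, where $\Omega_n$ is the volume of the unit ball of $\mathbb R^n$. The set $\mathbb C\mathbb R^{n+1}\setminus\{0\}$ is parametrized bijectively by $(\theta,a)\in[0,\pi)\times(\mathbb R^{n+1}\setminus\{0\})$, and we give it, in the chart $0<\theta<\pi$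 (whose complement is a null set), the orientation for which $-C_n\,d\theta\wedge dV_a$ is positive. **Theorem.** As $\varepsilon\to0^+$, the currents $$(dd^c(h_\varepsilon\circ\Phi))^n\wedge\frac{i\,dz_{n+1}\wedge d\bar z_{n+1}}{2|1+z_{n+1}|^2}$$ of degree $2n+2$ on $W$ converge weakly, and the limit, denoted by $(dd^c(h\circ\Phi))^n\wedge\frac{i\,dz_{n+1}\wedge d\bar z_{n+1}}{2|1+z_{n+1}|^2}$, is the pullback by $\tilde\Phi$ of the current of integration along $\mathbb C\mathbb R^{n+1}$ of the $(n+2)$-form $-C_n|a|^{-(n+1)}\,d\theta\wedge dV_a$. That is, for every $\chi\in C_c^\infty(W)$, $$\lim_{\varepsilon\to0^+}\int_W\chi\,(dd^c(h_\varepsilon\circ\Phi))^n\wedge\frac{i\,dz_{n+1}\wedge d\bar z_{n+1}}{2|1+z_{n+1}|^2}=\int_{\mathbb C\mathbb R^{n+1}}(\tilde\Phi_*\chi)\,\big(-C_n|a|^{-(n+1)}\big)\,d\theta\wedge dV_a .$$ With the chosen orientation, the right-hand side equals $n!\,\Omega_n\int_0^\pi\int_{\mathbb R^{n+1}}\tilde\Phi_*\chi(e^{i\theta}a)\,|a|^{-(n+1)}\,dV_a\,d\theta$,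 where $dV_a$ now denotes Lebesgue measure. -/

import Mathlib

noncomputable section

namespace LieMA

open MeasureTheory

/-- The open unit polydisc `𝔻^m` in `ℂ^m`. -/
def polydisc (m : ℕ) : Set (Fin m → ℂ) := {z | ∀ j, ‖z j‖ < 1}

/-! ### The regularized Lie norm -/

/-- The square of the Hermitian norm, `|ζ|² = ∑ |ζ_j|²`. -/
def hermSq {N : ℕ} (ζ : Fin N → ℂ) : ℝ := ∑ j, ‖ζ j‖ ^ 2

/-- The bilinear square `⟨ζ,ζ⟩ = ∑ ζ_j²`. -/
def bilSq {N : ℕ} (ζ : Fin N → ℂ) : ℂ := ∑ j, ζ j ^ 2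

/-- `A(ζ) = |a|²`, where `ζ = e^{iθ}(a + ib)` with `a ⟂ b` real and `|b| ≤ |a|`. -/
def lieA {N : ℕ} (ζ : Fin N → ℂ) : ℝ := (hermSq ζ + ‖bilSq ζ‖) / 2

/-- `B(ζ) = |b|²`, where `ζ = e^{iθ}(a + ib)` with `a ⟂ b` real and `|b| ≤ |a|`. -/
def lieB {N : ℕ} (ζ : Fin N → ℂ) : ℝ := (hermSq ζ - ‖bilSq ζ‖) / 2

/-- `v_ε = (|a|² + ε|b|²)^{1/2} + (|b|² + ε|a|²)^{1/2}`; `v_0` is the Lie norm. -/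
def vReg (ε : ℝ) {N : ℕ} (ζ : Fin N → ℂ) : ℝ :=
  √(lieA ζ + ε * lieB ζ) + √(lieB ζ + ε * lieA ζ)

/-- `h_ε = log v_ε`. -/
def hReg (ε : ℝ) {N : ℕ} (ζ : Fin N → ℂ) : ℝ := Real.log (vReg ε ζ)

/-! ### The Monge-Ampère operator on smooth functions -/

/-- The Wirtinger derivative `∂f/∂z_j = (∂f/∂x_j - i ∂f/∂y_j)/2`. -/
def dz {m : ℕ} (j : Fin m) (f : (Fin m → ℂ) → ℂ) (z : Fin m → ℂ) : ℂ :=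
  (fderiv ℝ f z (Pi.single j 1) - Complex.I * fderiv ℝ f z (Pi.single j Complex.I)) / 2

/-- The Wirtinger derivative `∂f/∂z̄_j = (∂f/∂x_j + i ∂f/∂y_j)/2`. -/
def dzbar {m : ℕ} (j : Fin m) (f : (Fin m → ℂ) → ℂ) (z : Fin m → ℂ) : ℂ :=
  (fderiv ℝ f z (Pi.single j 1) + Complex.I * fderiv ℝ f z (Pi.single j Complex.I)) / 2

/-- The Levi matrix `(∂²u/∂z_j∂z̄_k)_{j,k}` of a real function. -/
def leviMatrix {m : ℕ} (u : (Fin m → ℂ) → ℝ) (z : Fin m → ℂ) : Matrix (Fin m) (Fin m) ℂ :=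
  Matrix.of fun j k => dz j (dzbar k fun w => (u w : ℂ)) z

/-- The density of `(dd^c u)^m = 4^m m! det(∂²u/∂z_j∂z̄_k) dV` with respect to the Euclidean volume
form `dV` of `ℂ^m`, where `d^c = i(∂̄ - ∂)`. -/
def mongeAmpere {m : ℕ} (u : (Fin m → ℂ) → ℝ) (z : Fin m → ℂ) : ℂ :=
  4 ^ m * (m.factorial : ℂ) * (leviMatrix u z).det

/-! ### Currents of top degree, as functionals on test functions -/

/-- `χ ∈ C_c^∞(W)`, complex valued. -/
def IsTestFunction {m : ℕ} (W : Set (Fin m → ℂ)) (χ : (Fin m → ℂ) → ℂ) : Prop :=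
  ContDiff ℝ (⊤ : ℕ∞) χ ∧ HasCompactSupport χ ∧ tsupport χ ⊆ W

/-- The current `(dd^c u)^n ∧ i dz_{n+1} ∧ dz̄_{n+1} / (2|1+z_{n+1}|²)` on `ℂ^{n+1}`, for a function
`u` of `z_1, …, z_n` that is smooth where the test functions live. Here
`dV_n ∧ (i/2) dz_{n+1} ∧ dz̄_{n+1} = dV_{n+1}`, and `volume` is the measure of `dV_{n+1}`. -/
def mongeAmpereWedge {n : ℕ} (u : (Fin n → ℂ) → ℝ) (χ : (Fin (n + 1) → ℂ) → ℂ) : ℂ :=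
  ∫ z : Fin (n + 1) → ℂ,
    χ z * (mongeAmpere u (fun j => z j.castSucc) / ((‖1 + z (Fin.last n)‖ ^ 2 : ℝ) : ℂ))

/-- The direct image `F_*χ(ζ) = ∑_{w ∈ W, F(w) = ζ} χ(w)` of a function under `F|_W`. If `F` is a
local homeomorphism on `W` and `χ` has compact support in `W`, the sum is finite. -/
def directImage {m : ℕ} (F : (Fin m → ℂ) → (Fin m → ℂ)) (W : Set (Fin m → ℂ))
    (χ : (Fin m → ℂ) → ℂ) (ζ : Fin m → ℂ) : ℂ :=
  ∑ᶠ (w : Fin m → ℂ) (_ : w ∈ W ∧ F w = ζ), χ w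

/-- The pullback on `W` of a current `T` of top degree by a map `F` that is locally biholomorphic
on `W`: `⟨F^*T, χ⟩ = ⟨T, F_*χ⟩`. -/
def pullbackCurrent {m : ℕ} (F : (Fin m → ℂ) → (Fin m → ℂ)) (W : Set (Fin m → ℂ))
    (T : ((Fin m → ℂ) → ℂ) → ℂ) (χ : (Fin m → ℂ) → ℂ) : ℂ :=
  T (directImage F W χ)

/-! ### Integration along `ℂℝ^{n+1}` -/

/-- The parametrization `(θ, a) ↦ e^{iθ} a` of `ℂℝ^N`. On `[0, π) × (ℝ^N ∖ {0})` it is a bijection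
onto `ℂℝ^N ∖ {0}`, since `(θ, a)` and `(θ + π, -a)` give the same point. -/
def crParam {N : ℕ} (θ : ℝ) (a : EuclideanSpace ℝ (Fin N)) : Fin N → ℂ :=
  fun j => Complex.exp (θ * Complex.I) * (a j : ℂ)

/-- The volume `Ω_n` of the unit ball of `ℝ^n`. -/
def ballVol (n : ℕ) : ℝ := (volume (Metric.ball (0 : EuclideanSpace ℝ (Fin n)) 1)).toReal

/-- `C_n = (-1)^{n(n-1)/2} n! Ω_n`. -/
def constC (n : ℕ) : ℝ := (-1) ^ (n * (n - 1) / 2) * (n.factorial : ℝ) * ballVol n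

/-- The sign of the form `dθ ∧ dV_a` for the orientation of `ℂℝ^{n+1}`. The orientation is the one
for which `-C_n |a|^{-(n+1)} dθ ∧ dV_a` is a positive form. (For even `n` the manifold
`ℂℝ^{n+1} ∖ {0}` is not orientable, `dθ ∧ dV_a` changes sign under `(θ, a) ↦ (θ + π, -a)`, and the
orientation is that of the chart `0 < θ < π`, whose complement has measure zero.) -/
def crOrientation (n : ℕ) : ℝ := -(-1) ^ (n * (n - 1) / 2)

/-- The current of integration along `ℂℝ^{n+1}` of the `(n+2)`-form `f(θ, a) dθ ∧ dV_a`. -/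
def crIntegrationCurrent (n : ℕ) (f : ℝ → EuclideanSpace ℝ (Fin (n + 1)) → ℝ)
    (ψ : (Fin (n + 1) → ℂ) → ℂ) : ℂ :=
  ∫ p in Set.Ioo (0 : ℝ) Real.pi ×ˢ (Set.univ : Set (EuclideanSpace ℝ (Fin (n + 1)))),
    ψ (crParam p.1 p.2) * ((crOrientation n * f p.1 p.2 : ℝ) : ℂ)

/-! ### The auxiliary map -/

/-- `Φ̃(z, z_{n+1}) = (1 + z_{n+1}) Φ(z)`. -/
def tildeMap {n : ℕ} (Φ : (Fin n → ℂ) → (Fin (n + 1) → ℂ)) (z : Fin (n + 1) → ℂ) :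
    Fin (n + 1) → ℂ :=
  (1 + z (Fin.last n)) • Φ (fun j => z j.castSucc)

/-- `W = {z ∈ 𝔻^{n+1} ; det J_Φ̃(z) ≠ 0}`. -/
def regularSet {n : ℕ} (Φ : (Fin n → ℂ) → (Fin (n + 1) → ℂ)) : Set (Fin (n + 1) → ℂ) :=
  {z | z ∈ polydisc (n + 1) ∧ (fderiv ℂ (tildeMap Φ) z).det ≠ 0}

end LieMA

end

/-! The currents are pullbacks by Φ̃ of explicit measures on ℂ^{n+1} ∖ {0}, and these measures
concentrate on ℂℝ^{n+1} as ε → 0.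

Put κ = (1 - ε)/(1 + ε), S = |ζ|², R = (S² - κ²|⟨ζ,ζ⟩|²)^{1/2} and G = S + R. Squaring v_ε gives (1
+ ε)G, so h_ε = ½ log((1 + ε)G) (`hReg_eq`). Let p be the ζ̄-gradient and H the complex Hessian of
G. The Levi matrix of h_ε is (H - p̄pᵀ/G)/(2G). Since G(tζ) = |t|²G(ζ), Euler's relations express p
and G through H and ζ. After composition with Φ, the determinant therefore becomes a Schur
complement in KHK^*, where K has the rows ∂_jΦ and, last, Φ (`det_levi_comp`). As H is a multiple of
the identity plus a matrix of rank at most two, det H = (G/R)^{n+1} S(1 - κ²)/R (`det_sqNormHess`).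
All powers of G cancel, and the density is |det K|² times `lieDensity` = 2^n n!(1 - κ²)S/R^{n+2} at
Φ. The Jacobian of Φ̃ is (1 + z_{n+1})^n det K and `lieDensity` is homogeneous of degree -(2n+2),
which yields the pullback statement, weight 1/|1 + z_{n+1}|² included (`mongeAmpere_div_eq`).

It remains to let κ → 1. For ζ = y + ia, R² = (1 - κ²)S² + 4κ² Gram(y, a), and the Gram determinant
vanishes exactly when y and a are linearly dependent, that is, on ℂℝ^{n+1}. For fixed a ≠ 0, write y
as its component τ along a plus (1 - κ²)^{1/2}u with u transversal. All singular factors 1 - κ² then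
cancel (`lieDensity_cplx_rescaled`), and dominated convergence applies, first on slices, then in a
(`tendsto_integral_mul_lieDensity`). In the limit, the integral over u gives n! Ω_n / ((τ² +
|a|²)|a|^n). The substitutions τ = |a| cot θ and a ↦ a/sin θ turn this into n! Ω_n |a|^{-(n+1)} dV_a
dθ (`crIntegrationCurrent_eq_integral`).

Finally, χ is split into finitely many pieces supported where Φ̃ is injective (`exists_partition`),
on which the pullback is an ordinary change of variables (`integral_directImage_mul`). -/

open MeasureTheory Metric Set Filter Topology in
-- Cauchy's formula on the complex line through w in the direction v writes the derivative as a
-- circle integral of f. Cauchy's estimate bounds the integrand's derivative, so one may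
-- differentiate under the integral sign.
theorem LieMA.differentiableAt_fderiv_apply {m : ℕ} {f : (Fin m → ℂ) → ℂ} {U : Set (Fin m → ℂ)}
    (hU : IsOpen U) (hf : DifferentiableOn ℂ f U) {z : Fin m → ℂ} (hz : z ∈ U) (v : Fin m → ℂ) :
    DifferentiableAt ℂ (fun w => fderiv ℂ f w v) z := by
  obtain ⟨ρ, hρ, hball⟩ : ∃ ρ > 0, closedBall z ρ ⊆ U :=
    nhds_basis_closedBall.mem_iff.1 (hU.mem_nhds hz)
  have hcont : ContinuousOn f U := hf.continuousOn
  obtain ⟨C, hC⟩ := (isCompact_closedBall z ρ).exists_bound_of_continuousOn (hcont.mono hball)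
  have hfd : ∀ w ∈ U, HasFDerivAt f (fderiv ℂ f w) w := fun w hw =>
    (hf.differentiableAt (hU.mem_nhds hw)).hasFDerivAt
  have hbd : ∀ w ∈ ball z (ρ / 2), ‖fderiv ℂ f w‖ ≤ 2 * C / (ρ / 2) := by
    intro w hw
    have hsub : ball w (ρ / 2) ⊆ closedBall z ρ := fun x hx => by
      rw [mem_ball] at hw hx
      rw [mem_closedBall]
      linarith [dist_triangle x w z]
    -- The numerator is 2C because the image is compared with f w: values bounded by C lie within 2C
    -- of each other.
    refine Complex.norm_fderiv_le_div_of_mapsTo_ball (hf.mono (hsub.trans hball)) ?_ (by positivity)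
    intro x hx
    rw [mem_closedBall, dist_eq_norm]
    have h1 := hC x (hsub hx)
    have h2 := hC w (hsub (mem_ball_self (by positivity)))
    linarith [norm_sub_le (f x) (f w)]
  obtain ⟨r, hr, hrv⟩ : ∃ r > 0, r * ‖v‖ ≤ ρ / 4 := by
    -- The summand 1 covers v = 0.
    refine ⟨ρ / 4 / (‖v‖ + 1), by positivity, ?_⟩
    rw [div_mul_eq_mul_div, div_le_iff₀ (by positivity)]
    nlinarith [norm_nonneg v]
  have hmem : ∀ w ∈ ball z (ρ / 4), ∀ t : ℂ, ‖t‖ ≤ r → w + t • v ∈ ball z (ρ / 2) := by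
    intro w hw t ht
    rw [mem_ball, dist_eq_norm] at *
    calc ‖w + t • v - z‖ = ‖(w - z) + t • v‖ := by ring_nf
      _ ≤ ‖w - z‖ + ‖t‖ * ‖v‖ := (norm_add_le _ _).trans (by rw [norm_smul])
      _ < ρ / 4 + ρ / 4 := add_lt_add_of_lt_of_le hw
          ((mul_le_mul_of_nonneg_right ht (norm_nonneg v)).trans hrv)
      _ = ρ / 2 := by ring
  have hball' : ball z (ρ / 2) ⊆ U :=
    (ball_subset_closedBall.trans (closedBall_subset_closedBall (by linarith))).trans hball
  have key : ∀ w ∈ ball z (ρ / 4), fderiv ℂ f w v =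
      (2 * Real.pi * Complex.I : ℂ)⁻¹ • ∮ t in C(0, r), ((t - 0) ^ 2)⁻¹ • f (w + t • v) := by
    intro w hw
    have hlin : ∀ t : ℂ, HasDerivAt (fun t : ℂ => w + t • v) v t := fun t => by
      simpa using ((hasDerivAt_id t).smul_const v).const_add w
    have hV : IsOpen ((fun t : ℂ => w + t • v) ⁻¹' ball z (ρ / 2)) :=
      isOpen_ball.preimage (by fun_prop)
    have hd : DifferentiableOn ℂ (fun t : ℂ => f (w + t • v))
        ((fun t : ℂ => w + t • v) ⁻¹' ball z (ρ / 2)) := fun t ht =>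
      ((hfd _ (hball' ht)).comp_hasDerivAt t (hlin t)).differentiableAt.differentiableWithinAt
    have h0 : deriv (fun t : ℂ => f (w + t • v)) 0 = fderiv ℂ f w v := by
      have hw' : w + (0 : ℂ) • v ∈ U := hball' (hmem w hw 0 (by simpa using hr.le))
      have := ((hfd _ hw').comp_hasDerivAt (0 : ℂ) (hlin 0)).deriv
      simpa [Function.comp_def] using this
    rw [← h0, ← Complex.cderiv_eq_deriv hV hd hr]
    · rfl
    · intro t ht
      exact hmem w hw t (by simpa using ht)
  have hzb : z ∈ ball z (ρ / 4) := mem_ball_self (by positivity)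
  have hev : (fun w => fderiv ℂ f w v) =ᶠ[𝓝 z] fun w => (2 * Real.pi * Complex.I : ℂ)⁻¹ •
      ∮ t in C(0, r), ((t - 0) ^ 2)⁻¹ • f (w + t • v) := by
    filter_upwards [isOpen_ball.mem_nhds hzb] with w hw using key w hw
  refine DifferentiableAt.congr_of_eventuallyEq ?_ hev
  suffices h : DifferentiableAt ℂ
      (fun w => ∮ t in C(0, r), ((t - 0) ^ 2)⁻¹ • f (w + t • v)) z from h.fun_const_smul _
  set c : ℝ → ℂ := fun θ => deriv (circleMap 0 r) θ * ((circleMap 0 r θ - 0) ^ 2)⁻¹ with hc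
  have hcirc : ∀ θ, ‖circleMap 0 r θ‖ = r := fun θ => by simp [abs_of_pos hr]
  have hcm : Continuous (circleMap 0 r) := continuous_circleMap 0 r
  have hcc : Continuous c := by
    simp only [hc, deriv_circleMap]
    refine (hcm.mul continuous_const).mul (Continuous.inv₀ (by fun_prop) fun θ => ?_)
    have : circleMap 0 r θ ≠ 0 := by
      rw [← norm_ne_zero_iff, hcirc]; exact hr.ne'
    simpa using this
  have hint : (fun w => ∮ t in C(0, r), ((t - 0) ^ 2)⁻¹ • f (w + t • v)) =
      fun w => ∫ θ in (0 : ℝ)..2 * Real.pi, c θ • f (w + circleMap 0 r θ • v) := by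
    funext w
    simp only [circleIntegral, hc, smul_eq_mul, mul_assoc]
  rw [hint]
  have hFc : ∀ w ∈ ball z (ρ / 4), Continuous fun θ => c θ • f (w + circleMap 0 r θ • v) := by
    intro w hw
    refine hcc.smul ?_
    exact hcont.comp_continuous (by fun_prop) fun θ => hball' (hmem w hw _ (hcirc θ).le)
  refine (intervalIntegral.hasFDerivAt_integral_of_dominated_of_fderiv_le (𝕜 := ℂ)
    (bound := fun θ => ‖c θ‖ * (2 * C / (ρ / 2)))
    (F' := fun w θ => c θ • fderiv ℂ f (w + circleMap 0 r θ • v))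
    (isOpen_ball.mem_nhds hzb) ?_ ?_ ?_ ?_ ?_ ?_).differentiableAt
  · filter_upwards [isOpen_ball.mem_nhds hzb] with w hw
    exact (hFc w hw).aestronglyMeasurable
  · exact (hFc z hzb).intervalIntegrable _ _
  · refine (hcc.aestronglyMeasurable).smul ?_
    have h1 : Measurable (fderiv ℂ f) := measurable_fderiv ℂ f
    have h2 : Measurable fun θ => fderiv ℂ f (z + circleMap 0 r θ • v) :=
      h1.comp (Continuous.measurable (by fun_prop))
    exact h2.aestronglyMeasurable
  · refine .of_forall fun θ _ w hw => ?_
    rw [norm_smul]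
    exact mul_le_mul_of_nonneg_left (hbd _ (hmem w hw _ (hcirc θ).le)) (norm_nonneg _)
  · exact (Continuous.intervalIntegrable (by fun_prop) _ _)
  · refine .of_forall fun θ _ w hw => ?_
    refine HasFDerivAt.const_smul ?_ (c θ)
    have hh : HasFDerivAt (fun w => w + circleMap 0 r θ • v) (ContinuousLinearMap.id ℂ _) w :=
      (hasFDerivAt_id w).add_const _
    simpa [Function.comp_def] using (hfd _ (hball' (hmem w hw _ (hcirc θ).le))).comp w hh

/-! ### Wirtinger calculus and the Levi matrix of a composition. -/

namespace LieMA
open Complex Topology Filter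

/-- A common form of the Wirtinger derivatives: `dz` for `c = -i` and `dzbar` for `c = i`. -/
noncomputable def wirt {m : ℕ} (c : ℂ) (j : Fin m) (f : (Fin m → ℂ) → ℂ) (z : Fin m → ℂ) : ℂ :=
  (fderiv ℝ f z (Pi.single j 1) + c * fderiv ℝ f z (Pi.single j I)) / 2

section Wirtinger

variable {m N : ℕ} {c : ℂ} {j : Fin m} {f g : (Fin m → ℂ) → ℂ} {z : Fin m → ℂ}

theorem dz_eq_wirt : dz j f z = wirt (-I) j f z := by
  simp [dz, wirt, sub_eq_add_neg]

theorem dzbar_eq_wirt : dzbar j f z = wirt I j f z := rfl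

theorem wirt_congr (h : f =ᶠ[𝓝 z] g) : wirt c j f z = wirt c j g z := by
  simp [wirt, h.fderiv_eq]

theorem wirt_add (hf : DifferentiableAt ℝ f z) (hg : DifferentiableAt ℝ g z) :
    wirt c j (fun w => f w + g w) z = wirt c j f z + wirt c j g z := by
  simp only [wirt, fderiv_fun_add hf hg, _root_.add_apply]; ring

theorem wirt_sub (hf : DifferentiableAt ℝ f z) (hg : DifferentiableAt ℝ g z) :
    wirt c j (fun w => f w - g w) z = wirt c j f z - wirt c j g z := by
  simp only [wirt, fderiv_fun_sub hf hg, _root_.sub_apply]; ring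

theorem wirt_mul (hf : DifferentiableAt ℝ f z) (hg : DifferentiableAt ℝ g z) :
    wirt c j (fun w => f w * g w) z = f z * wirt c j g z + wirt c j f z * g z := by
  simp only [wirt, fderiv_fun_mul hf hg, _root_.add_apply,
    _root_.smul_apply, smul_eq_mul]; ring

theorem wirt_const_mul (a : ℂ) (hf : DifferentiableAt ℝ f z) :
    wirt c j (fun w => a * f w) z = a * wirt c j f z := by
  simp only [wirt, fderiv_const_mul hf, _root_.smul_apply, smul_eq_mul]; ring

theorem wirt_sum {ι : Type*} (s : Finset ι) {F : ι → (Fin m → ℂ) → ℂ}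
    (hF : ∀ i ∈ s, DifferentiableAt ℝ (F i) z) :
    wirt c j (fun w => ∑ i ∈ s, F i w) z = ∑ i ∈ s, wirt c j (F i) z := by
  simp only [wirt, fderiv_fun_sum hF, _root_.sum_apply, Finset.mul_sum,
    ← Finset.sum_add_distrib, Finset.sum_div]

/-- The chain rule for a real function of a real function. -/
theorem wirt_comp_real {φ : ℝ → ℝ} {φ' : ℝ} {r : (Fin m → ℂ) → ℝ} (hφ : HasDerivAt φ φ' (r z))
    (hr : DifferentiableAt ℝ r z) :
    wirt c j (fun w => (φ (r w) : ℂ)) z = φ' * wirt c j (fun w => (r w : ℂ)) z := by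
  have h1 : HasFDerivAt (fun w => (r w : ℂ)) (ofRealCLM.comp (fderiv ℝ r z)) z :=
    ofRealCLM.hasFDerivAt.comp z hr.hasFDerivAt
  have h2 : HasFDerivAt (fun w => (φ (r w) : ℂ)) (ofRealCLM.comp (φ' • fderiv ℝ r z)) z :=
    ofRealCLM.hasFDerivAt.comp z (hφ.comp_hasFDerivAt z hr.hasFDerivAt)
  simp only [wirt, h1.fderiv, h2.fderiv, ContinuousLinearMap.comp_apply,
    _root_.smul_apply, ofRealCLM_apply, smul_eq_mul, ofReal_mul]
  ring

theorem wirt_proj (c : ℂ) (j i : Fin m) (z : Fin m → ℂ) :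
    wirt c j (fun w => w i) z = if i = j then (1 + c * I) / 2 else 0 := by
  have : HasFDerivAt (𝕜 := ℝ) (fun w : Fin m → ℂ => w i)
      (ContinuousLinearMap.proj (R := ℝ) (φ := fun _ : Fin m => ℂ) i) z :=
    (ContinuousLinearMap.proj (R := ℝ) (φ := fun _ : Fin m => ℂ) i).hasFDerivAt
  simp only [wirt, this.fderiv, ContinuousLinearMap.proj_apply, Pi.single_apply]
  split_ifs <;> simp

theorem wirt_conj (hf : DifferentiableAt ℝ f z) :
    wirt c j (fun w => (starRingEnd ℂ) (f w)) z =
      (starRingEnd ℂ) (wirt ((starRingEnd ℂ) c) j f z) := by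
  have : HasFDerivAt (fun w => (starRingEnd ℂ) (f w))
      ((conjCLE : ℂ →L[ℝ] ℂ).comp (fderiv ℝ f z)) z :=
    (conjCLE : ℂ →L[ℝ] ℂ).hasFDerivAt.comp z hf.hasFDerivAt
  simp only [wirt, this.fderiv]
  simp [map_ofNat]

/-- The Cauchy-Riemann equations: the factor (1 + cI)/2 is 1 for c = -I and 0 for c = I. -/
theorem wirt_holo (hf : DifferentiableAt ℂ f z) :
    wirt c j f z = (1 + c * I) / 2 * fderiv ℂ f z (Pi.single j 1) := by
  have h : fderiv ℝ f z = (fderiv ℂ f z).restrictScalars ℝ :=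
    (hf.hasFDerivAt.restrictScalars ℝ).fderiv
  have h2 : (Pi.single j I : Fin m → ℂ) = I • Pi.single j 1 := by
    rw [← Pi.single_smul, smul_eq_mul, mul_one]
  simp only [wirt, h, ContinuousLinearMap.coe_restrictScalars', h2, map_smul, smul_eq_mul]
  ring

theorem dz_conj_holo (hf : DifferentiableAt ℂ f z) :
    dz j (fun w => (starRingEnd ℂ) (f w)) z = 0 := by
  rw [dz_eq_wirt, wirt_conj (hf.restrictScalars ℝ), wirt_holo hf]; simp

/-- A real-linear functional on `ℂ^N` in terms of its Wirtinger coefficients. -/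
theorem fderiv_eq_sum_wirt (u : (Fin N → ℂ) → ℂ) (ζ v : Fin N → ℂ) :
    fderiv ℝ u ζ v = ∑ l, (dz l u ζ * v l + dzbar l u ζ * (starRingEnd ℂ) (v l)) := by
  have hv : v = ∑ l, ((v l).re • (Pi.single l 1 : Fin N → ℂ) +
      (v l).im • (Pi.single l I : Fin N → ℂ)) := by
    funext i
    simp only [Finset.sum_apply, Pi.add_apply, Pi.smul_apply, Pi.single_apply, real_smul]
    simp only [mul_ite, mul_zero, Finset.sum_add_distrib, Finset.sum_ite_eq, Finset.mem_univ,
      if_true, mul_one, re_add_im]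
  conv_lhs => rw [hv]
  rw [map_sum]
  refine Finset.sum_congr rfl fun l _ => ?_
  rw [map_add, map_smul, map_smul, dz, dzbar, real_smul, real_smul]
  conv_rhs => rw [← re_add_im (v l)]
  simp only [map_add, map_mul, conj_ofReal, conj_I]
  linear_combination (v l).im * fderiv ℝ u ζ (Pi.single l I) * I_mul_I

variable {F : (Fin m → ℂ) → (Fin N → ℂ)} {u : (Fin N → ℂ) → ℂ}

/-- The chain rule for a smooth function of a holomorphic map. -/
theorem wirt_comp_holo (hu : DifferentiableAt ℝ u (F z)) (hF : DifferentiableAt ℂ F z) :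
    wirt c j (fun w => u (F w)) z =
      ∑ l, ((1 + c * I) / 2 * dz l u (F z) * fderiv ℂ F z (Pi.single j 1) l +
        (1 - c * I) / 2 * dzbar l u (F z) *
          (starRingEnd ℂ) (fderiv ℂ F z (Pi.single j 1) l)) := by
  have h : HasFDerivAt (fun w => u (F w))
      ((fderiv ℝ u (F z)).comp ((fderiv ℂ F z).restrictScalars ℝ)) z :=
    hu.hasFDerivAt.comp z (hF.hasFDerivAt.restrictScalars ℝ)
  have h2 : (Pi.single j I : Fin m → ℂ) = I • Pi.single j 1 := by
    rw [← Pi.single_smul, smul_eq_mul, mul_one]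
  simp only [wirt, h.fderiv, ContinuousLinearMap.comp_apply,
    ContinuousLinearMap.coe_restrictScalars', h2, map_smul, fderiv_eq_sum_wirt u]
  rw [Finset.mul_sum, ← Finset.sum_add_distrib, Finset.sum_div]
  refine Finset.sum_congr rfl fun l _ => ?_
  simp only [Pi.smul_apply, smul_eq_mul, map_mul, conj_I]
  ring

/-- The Levi matrix of `u ∘ F` for a holomorphic map `F`. -/
theorem leviMatrix_comp {v : (Fin N → ℂ) → ℝ} {U : Set (Fin m → ℂ)} (hU : IsOpen U)
    (hF : DifferentiableOn ℂ F U) (hz : z ∈ U)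
    (hv : ∀ᶠ ζ in 𝓝 (F z), DifferentiableAt ℝ v ζ)
    (hv2 : ∀ l, DifferentiableAt ℝ (dzbar l fun ζ => (v ζ : ℂ)) (F z)) :
    leviMatrix (fun w => v (F w)) z =
      Matrix.of (fun j l => fderiv ℂ F z (Pi.single j 1) l) * leviMatrix v (F z) *
        (Matrix.of (fun j l => fderiv ℂ F z (Pi.single j 1) l)).conjTranspose := by
  have hFz : DifferentiableAt ℂ F z := hF.differentiableAt (hU.mem_nhds hz)
  have hcomp : ∀ w ∈ U, ∀ (e : Fin m → ℂ) l,
      fderiv ℂ F w e l = fderiv ℂ (fun w => F w l) w e := fun w hw e l => by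
    rw [fderiv_apply (hF.differentiableAt (hU.mem_nhds hw))]; rfl
  have hd : ∀ k l, DifferentiableAt ℂ (fun w => fderiv ℂ (fun w => F w l) w (Pi.single k 1)) z :=
    fun k l => differentiableAt_fderiv_apply hU (fun w hw => (differentiableWithinAt_pi.1 (hF w hw)) l) hz _
  ext j k
  have e1 : (dzbar k fun w => ((v (F w) : ℝ) : ℂ)) =ᶠ[𝓝 z] fun w =>
      ∑ l, dzbar l (fun ζ => (v ζ : ℂ)) (F w) *
        (starRingEnd ℂ) (fderiv ℂ (fun w => F w l) w (Pi.single k 1)) := by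
    filter_upwards [hU.mem_nhds hz, hFz.continuousAt.eventually hv] with w hw hvw
    rw [dzbar_eq_wirt, wirt_comp_holo (u := fun ζ => (v ζ : ℂ)) (ofRealCLM.differentiableAt.comp _ hvw)
      (hF.differentiableAt (hU.mem_nhds hw))]
    refine Finset.sum_congr rfl fun l _ => ?_
    rw [hcomp w hw]
    simp only [I_mul_I]; norm_num
  have hdF : ∀ l, DifferentiableAt ℝ (fun w => dzbar l (fun ζ => (v ζ : ℂ)) (F w)) z := fun l =>
    (hv2 l).comp z (hFz.restrictScalars ℝ)
  have hdc : ∀ l, DifferentiableAt ℝ (fun w => (starRingEnd ℂ)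
      (fderiv ℂ (fun w => F w l) w (Pi.single k 1))) z := fun l =>
    (conjCLE : ℂ →L[ℝ] ℂ).differentiableAt.comp z ((hd k l).restrictScalars ℝ)
  -- In the product formula of `e1` the second factors are conjugates of holomorphic functions,
  -- which ∂/∂z_j annihilates; only the first factors are differentiated.
  change dz j (dzbar k fun w => ((v (F w) : ℝ) : ℂ)) z = _
  rw [dz_eq_wirt, wirt_congr e1, wirt_sum _ fun l _ => (hdF l).fun_mul (hdc l)]
  simp only [Matrix.mul_apply, Matrix.conjTranspose_apply, Matrix.of_apply, leviMatrix]
  refine Finset.sum_congr rfl fun l _ => ?_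
  rw [wirt_mul (hdF l) (hdc l), ← dz_eq_wirt, dz_conj_holo (hd k l), mul_zero, zero_add,
    wirt_comp_holo (hv2 l) hFz, hcomp z hz, starRingEnd_apply]
  congr 1
  refine Finset.sum_congr rfl fun i _ => ?_
  rw [neg_mul, I_mul_I]
  norm_num
  ring

end Wirtinger
end LieMA

/-! ### First and second derivatives of G and of h_ε. -/

namespace LieMA
open Complex Topology Filter

/-- The radicand `|ζ|⁴ - κ²|⟨ζ,ζ⟩|²`. -/
noncomputable def radicand (κ : ℝ) {N : ℕ} (ζ : Fin N → ℂ) : ℝ :=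
  hermSq ζ ^ 2 - κ ^ 2 * ‖bilSq ζ‖ ^ 2

/-- `G = |ζ|² + (|ζ|⁴ - κ²|⟨ζ,ζ⟩|²)^{1/2}`, which is `v_ε² / (1 + ε)` for
`κ = (1 - ε) / (1 + ε)`. -/
noncomputable def sqNorm (κ : ℝ) {N : ℕ} (ζ : Fin N → ℂ) : ℝ := hermSq ζ + √(radicand κ ζ)

/-- The derivative `∂G/∂ζ̄_k`. -/
noncomputable def sqNormGrad (κ : ℝ) {N : ℕ} (k : Fin N) (ζ : Fin N → ℂ) : ℂ :=
  ζ k + (hermSq ζ * ζ k - κ ^ 2 * bilSq ζ * (starRingEnd ℂ) (ζ k)) / √(radicand κ ζ)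

/-- The complex Hessian of `G`. -/
noncomputable def sqNormHess (κ : ℝ) {N : ℕ} (ζ : Fin N → ℂ) : Matrix (Fin N) (Fin N) ℂ :=
  Matrix.of fun j k => (if k = j then 1 else 0) +
    ((starRingEnd ℂ) (ζ j) * ζ k + hermSq ζ * (if k = j then 1 else 0)
      - 2 * κ ^ 2 * ζ j * (starRingEnd ℂ) (ζ k)) / √(radicand κ ζ) -
    (hermSq ζ * ζ k - κ ^ 2 * bilSq ζ * (starRingEnd ℂ) (ζ k)) *
      (hermSq ζ * (starRingEnd ℂ) (ζ j) - κ ^ 2 * (starRingEnd ℂ) (bilSq ζ) * ζ j) /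
        √(radicand κ ζ) ^ 3

section Basic

variable {N : ℕ} {ζ : Fin N → ℂ} {κ : ℝ}

theorem hermSq_eq_sum (ζ : Fin N → ℂ) :
    (hermSq ζ : ℂ) = ∑ i, ζ i * (starRingEnd ℂ) (ζ i) := by
  simp [hermSq, mul_conj, normSq_eq_norm_sq]

theorem hermSq_pos (hζ : ζ ≠ 0) : 0 < hermSq ζ := by
  obtain ⟨i, hi⟩ := Function.ne_iff.1 hζ
  exact Finset.sum_pos' (fun j _ => by positivity) ⟨i, Finset.mem_univ _, by
    have : 0 < ‖ζ i‖ := norm_pos_iff.2 hi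
    positivity⟩

theorem hermSq_nonneg (ζ : Fin N → ℂ) : 0 ≤ hermSq ζ :=
  Finset.sum_nonneg fun _ _ => by positivity

theorem norm_bilSq_le (ζ : Fin N → ℂ) : ‖bilSq ζ‖ ≤ hermSq ζ :=
  (norm_sum_le _ _).trans_eq (by simp [hermSq])

/-- This uses |⟨ζ,ζ⟩| ≤ |ζ|². It is the effect of the regularization: for κ < 1 the radicand
vanishes only at 0, so G is smooth elsewhere. -/
theorem radicand_ge (κ : ℝ) (ζ : Fin N → ℂ) :
    (1 - κ ^ 2) * hermSq ζ ^ 2 ≤ radicand κ ζ := by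
  have := pow_le_pow_left₀ (norm_nonneg _) (norm_bilSq_le ζ) 2
  rw [radicand]
  nlinarith [sq_nonneg κ]

theorem radicand_pos (h0 : 0 ≤ κ) (h1 : κ < 1) (hζ : ζ ≠ 0) : 0 < radicand κ ζ := by
  refine lt_of_lt_of_le ?_ (radicand_ge κ ζ)
  have := hermSq_pos hζ
  have : 0 < 1 - κ ^ 2 := by nlinarith
  positivity

theorem sqrt_radicand_ne_zero (h0 : 0 ≤ κ) (h1 : κ < 1) (hζ : ζ ≠ 0) :
    ((√(radicand κ ζ) : ℝ) : ℂ) ≠ 0 :=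
  ofReal_ne_zero.2 (Real.sqrt_pos.2 (radicand_pos h0 h1 hζ)).ne'

theorem sq_sqrt_radicand (h0 : 0 ≤ κ) (h1 : κ < 1) (ζ : Fin N → ℂ) :
    ((√(radicand κ ζ) : ℝ) : ℂ) ^ 2 =
      hermSq ζ ^ 2 - κ ^ 2 * (bilSq ζ * (starRingEnd ℂ) (bilSq ζ)) := by
  have h : 0 ≤ radicand κ ζ := le_trans
    (mul_nonneg (by nlinarith) (sq_nonneg _)) (radicand_ge κ ζ)
  rw [← ofReal_pow, Real.sq_sqrt h, radicand, mul_conj, normSq_eq_norm_sq]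
  push_cast; ring

theorem sqNorm_pos (hζ : ζ ≠ 0) : 0 < sqNorm κ ζ :=
  add_pos_of_pos_of_nonneg (hermSq_pos hζ) (Real.sqrt_nonneg _)

theorem differentiable_hermSq : Differentiable ℝ (hermSq (N := N)) := fun ζ => by
  unfold hermSq
  exact DifferentiableAt.fun_sum fun i _ => (differentiableAt_apply i ζ).norm_sq ℝ

theorem differentiable_hermSq_ofReal :
    Differentiable ℝ (fun ζ : Fin N → ℂ => (hermSq ζ : ℂ)) :=
  ofRealCLM.differentiable.comp differentiable_hermSq

theorem differentiable_bilSq : Differentiable ℝ (bilSq (N := N)) := by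
  unfold bilSq
  fun_prop

theorem differentiable_conj_bilSq :
    Differentiable ℝ (fun ζ : Fin N → ℂ => (starRingEnd ℂ) (bilSq ζ)) :=
  (conjCLE : ℂ →L[ℝ] ℂ).differentiable.comp differentiable_bilSq

theorem differentiable_apply_real (i : Fin N) : Differentiable ℝ (fun ζ : Fin N → ℂ => ζ i) :=
  fun ζ => differentiableAt_apply i ζ

theorem differentiable_conj_apply (i : Fin N) :
    Differentiable ℝ (fun ζ : Fin N → ℂ => (starRingEnd ℂ) (ζ i)) :=
  (conjCLE : ℂ →L[ℝ] ℂ).differentiable.comp (differentiable_apply_real i)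

theorem differentiable_radicand : Differentiable ℝ (radicand κ (N := N)) := by
  unfold radicand
  refine (differentiable_hermSq.pow 2).sub (Differentiable.const_mul ?_ _)
  exact differentiable_bilSq.norm_sq ℝ

theorem differentiableAt_sqrt_radicand (h0 : 0 ≤ κ) (h1 : κ < 1) (hζ : ζ ≠ 0) :
    DifferentiableAt ℝ (fun w : Fin N → ℂ => √(radicand κ w)) ζ :=
  (differentiable_radicand ζ).sqrt (radicand_pos h0 h1 hζ).ne'

theorem differentiableAt_sqrt_radicand_ofReal (h0 : 0 ≤ κ) (h1 : κ < 1) (hζ : ζ ≠ 0) :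
    DifferentiableAt ℝ (fun w : Fin N → ℂ => ((√(radicand κ w) : ℝ) : ℂ)) ζ :=
  ofRealCLM.differentiableAt.comp ζ (differentiableAt_sqrt_radicand h0 h1 hζ)

variable (c : ℂ) (j : Fin N)

theorem wirt_conj_proj (i : Fin N) (ζ : Fin N → ℂ) :
    wirt c j (fun w => (starRingEnd ℂ) (w i)) ζ = if i = j then (1 - c * I) / 2 else 0 := by
  rw [wirt_conj (differentiable_apply_real i ζ), wirt_proj]
  split_ifs <;> simp [map_ofNat, sub_eq_add_neg]

theorem wirt_hermSq (ζ : Fin N → ℂ) : wirt c j (fun w => (hermSq w : ℂ)) ζ =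
    (1 + c * I) / 2 * (starRingEnd ℂ) (ζ j) + (1 - c * I) / 2 * ζ j := by
  simp only [hermSq_eq_sum]
  rw [wirt_sum _ fun i _ => (differentiable_apply_real i ζ).fun_mul (differentiable_conj_apply i ζ)]
  simp_rw [wirt_mul (differentiable_apply_real _ ζ) (differentiable_conj_apply _ ζ),
    wirt_conj_proj, wirt_proj, mul_ite, ite_mul, mul_zero, zero_mul, Finset.sum_add_distrib,
    Finset.sum_ite_eq', Finset.mem_univ, if_true]
  ring

theorem wirt_bilSq (ζ : Fin N → ℂ) : wirt c j bilSq ζ = (1 + c * I) * ζ j := by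
  have : bilSq (N := N) = fun w => ∑ i, w i * w i := by funext w; simp [bilSq, sq]
  rw [this,
    wirt_sum _ fun i _ => (differentiable_apply_real i ζ).fun_mul (differentiable_apply_real i ζ)]
  simp_rw [wirt_mul (differentiable_apply_real _ ζ) (differentiable_apply_real _ ζ),
    wirt_proj, mul_ite, ite_mul, mul_zero, zero_mul, Finset.sum_add_distrib,
    Finset.sum_ite_eq', Finset.mem_univ, if_true]
  ring

theorem wirt_conj_bilSq (ζ : Fin N → ℂ) :
    wirt c j (fun w => (starRingEnd ℂ) (bilSq w)) ζ = (1 - c * I) * (starRingEnd ℂ) (ζ j) := by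
  rw [wirt_conj (differentiable_bilSq ζ), wirt_bilSq]
  simp [sub_eq_add_neg]

theorem wirt_radicand (ζ : Fin N → ℂ) : wirt c j (fun w => (radicand κ w : ℂ)) ζ =
    (1 + c * I) * (hermSq ζ * (starRingEnd ℂ) (ζ j) - κ ^ 2 * (starRingEnd ℂ) (bilSq ζ) * ζ j) +
    (1 - c * I) * (hermSq ζ * ζ j - κ ^ 2 * bilSq ζ * (starRingEnd ℂ) (ζ j)) := by
  have : (fun w : Fin N → ℂ => (radicand κ w : ℂ)) = fun w =>
      (hermSq w : ℂ) * hermSq w - (κ ^ 2 : ℂ) * (bilSq w * (starRingEnd ℂ) (bilSq w)) := by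
    funext w
    rw [radicand, mul_conj, normSq_eq_norm_sq]
    push_cast; ring
  have hS := differentiable_hermSq_ofReal ζ
  have hQ := differentiable_bilSq ζ
  have hQ' := differentiable_conj_bilSq ζ
  rw [this, wirt_sub (hS.fun_mul hS) ((hQ.fun_mul hQ').const_mul _), wirt_mul hS hS,
    wirt_const_mul _ (hQ.fun_mul hQ'), wirt_mul hQ hQ', wirt_hermSq, wirt_conj_bilSq, wirt_bilSq]
  ring

theorem wirt_sqrt_radicand (h0 : 0 ≤ κ) (h1 : κ < 1) (hζ : ζ ≠ 0) :
    wirt c j (fun w => ((√(radicand κ w) : ℝ) : ℂ)) ζ =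
    ((1 + c * I) / 2 *
        (hermSq ζ * (starRingEnd ℂ) (ζ j) - κ ^ 2 * (starRingEnd ℂ) (bilSq ζ) * ζ j) +
      (1 - c * I) / 2 * (hermSq ζ * ζ j - κ ^ 2 * bilSq ζ * (starRingEnd ℂ) (ζ j))) /
      √(radicand κ ζ) := by
  have hR := sqrt_radicand_ne_zero h0 h1 hζ
  rw [wirt_comp_real (Real.hasDerivAt_sqrt (radicand_pos h0 h1 hζ).ne') (differentiable_radicand ζ),
    wirt_radicand]
  push_cast
  field_simp

end Basic

section Levi

variable {N : ℕ} {ζ : Fin N → ℂ} {κ : ℝ}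

theorem dzbar_sqNorm (h0 : 0 ≤ κ) (h1 : κ < 1) (hζ : ζ ≠ 0) (k : Fin N) :
    dzbar k (fun w => (sqNorm κ w : ℂ)) ζ = sqNormGrad κ k ζ := by
  simp only [sqNorm, ofReal_add]
  rw [dzbar_eq_wirt, wirt_add (differentiable_hermSq_ofReal ζ)
    (differentiableAt_sqrt_radicand_ofReal h0 h1 hζ), wirt_hermSq, wirt_sqrt_radicand _ _ h0 h1 hζ,
    sqNormGrad, I_mul_I]
  norm_num

theorem dz_sqNorm (h0 : 0 ≤ κ) (h1 : κ < 1) (hζ : ζ ≠ 0) (k : Fin N) :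
    dz k (fun w => (sqNorm κ w : ℂ)) ζ = (starRingEnd ℂ) (sqNormGrad κ k ζ) := by
  simp only [sqNorm, ofReal_add]
  rw [dz_eq_wirt, wirt_add (differentiable_hermSq_ofReal ζ)
    (differentiableAt_sqrt_radicand_ofReal h0 h1 hζ), wirt_hermSq, wirt_sqrt_radicand _ _ h0 h1 hζ,
    sqNormGrad, neg_mul, I_mul_I]
  simp

theorem differentiableAt_inv_sqrt_radicand (h0 : 0 ≤ κ) (h1 : κ < 1) (hζ : ζ ≠ 0) :
    DifferentiableAt ℝ (fun w : Fin N → ℂ => (((√(radicand κ w))⁻¹ : ℝ) : ℂ)) ζ :=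
  ofRealCLM.differentiableAt.comp ζ ((differentiableAt_sqrt_radicand h0 h1 hζ).inv
    (Real.sqrt_pos.2 (radicand_pos h0 h1 hζ)).ne')

theorem differentiable_sqNormGrad_num (k : Fin N) : Differentiable ℝ (fun w : Fin N → ℂ =>
    (hermSq w * w k - κ ^ 2 * (bilSq w * (starRingEnd ℂ) (w k)) : ℂ)) := fun w =>
  ((differentiable_hermSq_ofReal w).fun_mul (differentiable_apply_real k w)).fun_sub
    (((differentiable_bilSq w).fun_mul (differentiable_conj_apply k w)).const_mul _)

theorem sqNormGrad_eq (k : Fin N) : sqNormGrad κ k = fun w : Fin N → ℂ => w k +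
    (hermSq w * w k - κ ^ 2 * (bilSq w * (starRingEnd ℂ) (w k))) *
      (((√(radicand κ w))⁻¹ : ℝ) : ℂ) := by
  funext w; simp only [sqNormGrad, ofReal_inv]; ring

theorem differentiableAt_sqNormGrad (h0 : 0 ≤ κ) (h1 : κ < 1) (hζ : ζ ≠ 0) (k : Fin N) :
    DifferentiableAt ℝ (sqNormGrad κ k) ζ := by
  rw [sqNormGrad_eq]
  exact (differentiable_apply_real k ζ).fun_add ((differentiable_sqNormGrad_num k ζ).fun_mul
    (differentiableAt_inv_sqrt_radicand h0 h1 hζ))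

theorem dz_sqNormGrad (h0 : 0 ≤ κ) (h1 : κ < 1) (hζ : ζ ≠ 0) (j k : Fin N) :
    dz j (sqNormGrad κ k) ζ = sqNormHess κ ζ j k := by
  have hR := sqrt_radicand_ne_zero h0 h1 hζ
  have hS := differentiable_hermSq_ofReal ζ
  have hQ := differentiable_bilSq ζ
  have hk := differentiable_apply_real k ζ
  have hk' := differentiable_conj_apply k ζ
  have hinv := wirt_comp_real (c := -I) (j := j)
    (hasDerivAt_inv (Real.sqrt_pos.2 (radicand_pos h0 h1 hζ)).ne')
    (differentiableAt_sqrt_radicand h0 h1 hζ)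
  rw [sqNormGrad_eq, dz_eq_wirt, wirt_add hk ((differentiable_sqNormGrad_num k ζ).fun_mul
    (differentiableAt_inv_sqrt_radicand h0 h1 hζ)), wirt_mul (differentiable_sqNormGrad_num k ζ)
    (differentiableAt_inv_sqrt_radicand h0 h1 hζ), hinv, wirt_sub (hS.fun_mul hk)
    ((hQ.fun_mul hk').const_mul _), wirt_mul hS hk, wirt_const_mul _ (hQ.fun_mul hk'),
    wirt_mul hQ hk', wirt_sqrt_radicand _ _ h0 h1 hζ, wirt_hermSq, wirt_bilSq, wirt_conj_proj,
    wirt_proj, sqNormHess, neg_mul, I_mul_I]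
  simp only [Matrix.of_apply]
  push_cast
  split_ifs <;> (field_simp; ring)

/-- `h_ε` in terms of `G`. -/
theorem hReg_eq {ε : ℝ} (hε : 0 < ε) (hε1 : ε < 1) (ζ : Fin N → ℂ) :
    hReg ε ζ = 1 / 2 * Real.log ((1 + ε) * sqNorm ((1 - ε) / (1 + ε)) ζ) := by
  have hq := norm_bilSq_le ζ
  have hA : 0 ≤ lieA ζ := by
    have := hermSq_nonneg ζ
    unfold lieA; positivity
  have hB : 0 ≤ lieB ζ := by unfold lieB; linarith
  have h1 : 0 ≤ lieA ζ + ε * lieB ζ := by positivity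
  have h2 : 0 ≤ lieB ζ + ε * lieA ζ := by positivity
  have hv : 0 ≤ vReg ε ζ := by unfold vReg; positivity
  -- The cross term of v_ε². With A + B = |ζ|² and 4AB = |ζ|⁴ - |⟨ζ,ζ⟩|² one has (A + εB)(B + εA) =
  -- (1 - ε)²AB + ε(A + B)², which is (1 + ε)²/4 times the radicand.
  have h3 : √(lieA ζ + ε * lieB ζ) * √(lieB ζ + ε * lieA ζ) * 2 =
      (1 + ε) * √(radicand ((1 - ε) / (1 + ε)) ζ) := by
    rw [← Real.sqrt_mul h1, ← Real.sqrt_sq (show (0 : ℝ) ≤ 2 by norm_num),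
      ← Real.sqrt_mul (mul_nonneg h1 h2),
      ← Real.sqrt_sq (show (0 : ℝ) ≤ 1 + ε by linarith), ← Real.sqrt_mul (sq_nonneg _),
      Real.sqrt_sq (show (0 : ℝ) ≤ 1 + ε by linarith)]
    congr 1
    rw [radicand, lieA, lieB]
    have : 1 + ε ≠ 0 := by linarith
    field_simp
    ring
  have : (1 + ε) * sqNorm ((1 - ε) / (1 + ε)) ζ = vReg ε ζ ^ 2 := by
    rw [vReg, add_sq, Real.sq_sqrt h1, Real.sq_sqrt h2, sqNorm, mul_add, ← h3, lieA, lieB]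
    ring
  rw [this, Real.log_pow, hReg]
  push_cast; ring

theorem kappa_mem {ε : ℝ} (hε : 0 < ε) (hε1 : ε < 1) :
    0 ≤ (1 - ε) / (1 + ε) ∧ (1 - ε) / (1 + ε) < 1 :=
  ⟨div_nonneg (by linarith) (by linarith), by rw [div_lt_one (by linarith)]; linarith⟩

theorem differentiableAt_sqNorm (h0 : 0 ≤ κ) (h1 : κ < 1) (hζ : ζ ≠ 0) :
    DifferentiableAt ℝ (sqNorm κ (N := N)) ζ :=
  (differentiable_hermSq ζ).add (differentiableAt_sqrt_radicand h0 h1 hζ)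

theorem hasDerivAt_half_log_mul {a t : ℝ} (ha : 0 < a) (ht : 0 < t) :
    HasDerivAt (fun t => 1 / 2 * Real.log (a * t)) (1 / 2 * t⁻¹) t := by
  have := (((hasDerivAt_id t).const_mul a).log (mul_pos ha ht).ne').const_mul (1 / 2)
  refine this.congr_deriv ?_
  simp only [id]
  field_simp

theorem differentiableAt_hReg {ε : ℝ} (hε : 0 < ε) (hε1 : ε < 1) (hζ : ζ ≠ 0) :
    DifferentiableAt ℝ (hReg ε (N := N)) ζ := by
  obtain ⟨h0, h1⟩ := kappa_mem hε hε1
  rw [funext (hReg_eq (N := N) hε hε1)]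
  exact (hasDerivAt_half_log_mul (by linarith) (sqNorm_pos hζ)).differentiableAt.comp ζ
    (differentiableAt_sqNorm h0 h1 hζ)

theorem dzbar_hReg {ε : ℝ} (hε : 0 < ε) (hε1 : ε < 1) (hζ : ζ ≠ 0) (k : Fin N) :
    dzbar k (fun w => (hReg ε w : ℂ)) ζ =
      ((1 / 2 * (sqNorm ((1 - ε) / (1 + ε)) ζ)⁻¹ : ℝ) : ℂ) *
        sqNormGrad ((1 - ε) / (1 + ε)) k ζ := by
  obtain ⟨h0, h1⟩ := kappa_mem hε hε1
  simp only [hReg_eq hε hε1]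
  rw [dzbar_eq_wirt, wirt_comp_real (hasDerivAt_half_log_mul (by linarith) (sqNorm_pos hζ))
    (differentiableAt_sqNorm h0 h1 hζ), ← dzbar_eq_wirt, dzbar_sqNorm h0 h1 hζ]

theorem eventually_dzbar_hReg {ε : ℝ} (hε : 0 < ε) (hε1 : ε < 1) (hζ : ζ ≠ 0) (k : Fin N) :
    dzbar k (fun w => (hReg ε w : ℂ)) =ᶠ[𝓝 ζ] fun w =>
      ((1 / 2 * (sqNorm ((1 - ε) / (1 + ε)) w)⁻¹ : ℝ) : ℂ) *
        sqNormGrad ((1 - ε) / (1 + ε)) k w := by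
  filter_upwards [isOpen_ne.mem_nhds hζ] with w hw using dzbar_hReg hε hε1 hw k

theorem hasDerivAt_half_inv {t : ℝ} (ht : t ≠ 0) :
    HasDerivAt (fun t : ℝ => 1 / 2 * t⁻¹) (1 / 2 * -(t ^ 2)⁻¹) t :=
  (hasDerivAt_inv ht).const_mul _

theorem differentiableAt_half_inv_sqNorm (h0 : 0 ≤ κ) (h1 : κ < 1) (hζ : ζ ≠ 0) :
    DifferentiableAt ℝ (fun w : Fin N → ℂ => ((1 / 2 * (sqNorm κ w)⁻¹ : ℝ) : ℂ)) ζ :=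
  ofRealCLM.differentiableAt.comp ζ
    ((hasDerivAt_half_inv (sqNorm_pos hζ).ne').differentiableAt.comp ζ
      (differentiableAt_sqNorm h0 h1 hζ))

theorem differentiableAt_dzbar_hReg {ε : ℝ} (hε : 0 < ε) (hε1 : ε < 1) (hζ : ζ ≠ 0)
    (k : Fin N) : DifferentiableAt ℝ (dzbar k (fun w => (hReg ε w : ℂ))) ζ := by
  obtain ⟨h0, h1⟩ := kappa_mem hε hε1
  refine DifferentiableAt.congr_of_eventuallyEq ?_ (eventually_dzbar_hReg hε hε1 hζ k)
  exact (differentiableAt_half_inv_sqNorm h0 h1 hζ).fun_mul (differentiableAt_sqNormGrad h0 h1 hζ k)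

theorem leviMatrix_hReg {ε : ℝ} (hε : 0 < ε) (hε1 : ε < 1) (hζ : ζ ≠ 0) :
    leviMatrix (hReg ε) ζ =
      (2 * sqNorm ((1 - ε) / (1 + ε)) ζ : ℂ)⁻¹ • (sqNormHess ((1 - ε) / (1 + ε)) ζ -
        (sqNorm ((1 - ε) / (1 + ε)) ζ : ℂ)⁻¹ • Matrix.vecMulVec
          (fun j => (starRingEnd ℂ) (sqNormGrad ((1 - ε) / (1 + ε)) j ζ))
          (fun k => sqNormGrad ((1 - ε) / (1 + ε)) k ζ)) := by
  obtain ⟨h0, h1⟩ := kappa_mem hε hε1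
  have hG : (sqNorm ((1 - ε) / (1 + ε)) ζ : ℂ) ≠ 0 := ofReal_ne_zero.2 (sqNorm_pos hζ).ne'
  ext j k
  simp only [leviMatrix, Matrix.of_apply]
  rw [dz_eq_wirt, wirt_congr (eventually_dzbar_hReg hε hε1 hζ k),
    wirt_mul (differentiableAt_half_inv_sqNorm h0 h1 hζ) (differentiableAt_sqNormGrad h0 h1 hζ k),
    wirt_comp_real (hasDerivAt_half_inv (sqNorm_pos hζ).ne') (differentiableAt_sqNorm h0 h1 hζ),
    ← dz_eq_wirt, ← dz_eq_wirt, dz_sqNormGrad h0 h1 hζ, dz_sqNorm h0 h1 hζ]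
  simp only [Matrix.smul_apply, Matrix.sub_apply, Matrix.vecMulVec_apply, smul_eq_mul]
  push_cast
  field_simp
  ring

end Levi
end LieMA

/-! ### Euler relations, the determinant of the Hessian, and the Monge-Ampère density. -/

namespace LieMA
open Complex Topology Filter Matrix

section Hessian

variable {N : ℕ} {ζ : Fin N → ℂ} {κ : ℝ}

theorem sum_conj_mul (ζ : Fin N → ℂ) : ∑ i, (starRingEnd ℂ) (ζ i) * ζ i = (hermSq ζ : ℂ) := by
  rw [hermSq_eq_sum]
  exact Finset.sum_congr rfl fun _ _ => mul_comm _ _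

theorem sum_mul_self (ζ : Fin N → ℂ) : ∑ i, ζ i * ζ i = bilSq ζ := by
  simp [bilSq, sq]

theorem sum_conj_mul_conj (ζ : Fin N → ℂ) :
    ∑ i, (starRingEnd ℂ) (ζ i) * (starRingEnd ℂ) (ζ i) = (starRingEnd ℂ) (bilSq ζ) := by
  simp [bilSq, sq]

/-- Euler's relation: G is homogeneous of degree one in ζ̄. This supplies the corner entry G of the
bordered matrix in `det_levi_comp`. -/
theorem sum_sqNormGrad_mul_conj (h0 : 0 ≤ κ) (h1 : κ < 1) (hζ : ζ ≠ 0) :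
    ∑ k, sqNormGrad κ k ζ * (starRingEnd ℂ) (ζ k) = sqNorm κ ζ := by
  have hR := sqrt_radicand_ne_zero h0 h1 hζ
  have hR2 := sq_sqrt_radicand h0 h1 ζ
  have : ∀ k, sqNormGrad κ k ζ * (starRingEnd ℂ) (ζ k) =
      (1 + hermSq ζ / √(radicand κ ζ)) * (ζ k * (starRingEnd ℂ) (ζ k)) -
        κ ^ 2 * bilSq ζ / √(radicand κ ζ) * ((starRingEnd ℂ) (ζ k) * (starRingEnd ℂ) (ζ k)) := by
    intro k; rw [sqNormGrad]; ring
  simp_rw [this, Finset.sum_sub_distrib, ← Finset.mul_sum, sum_conj_mul_conj, ← hermSq_eq_sum,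
    sqNorm]
  push_cast
  field_simp
  linear_combination -hR2

/-- Euler's relation for ∂G/∂ζ̄_k, which is homogeneous of degree one in ζ and of degree zero in ζ̄.
The verification uses only the formula for the square of the root. -/
theorem vecMul_sqNormHess (h0 : 0 ≤ κ) (h1 : κ < 1) (hζ : ζ ≠ 0) (k : Fin N) :
    ∑ j, ζ j * sqNormHess κ ζ j k = sqNormGrad κ k ζ := by
  have hR := sqrt_radicand_ne_zero h0 h1 hζ
  have hR2 := sq_sqrt_radicand h0 h1 ζ
  set R : ℂ := ((√(radicand κ ζ) : ℝ) : ℂ)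
  have : ∀ j, ζ j * sqNormHess κ ζ j k = (ζ j * if k = j then (1 + hermSq ζ / R) else 0) +
      (ζ k / R - (hermSq ζ * ζ k - κ ^ 2 * bilSq ζ * (starRingEnd ℂ) (ζ k)) * hermSq ζ / R ^ 3) *
        (ζ j * (starRingEnd ℂ) (ζ j)) +
      (- 2 * κ ^ 2 * (starRingEnd ℂ) (ζ k) / R +
        (hermSq ζ * ζ k - κ ^ 2 * bilSq ζ * (starRingEnd ℂ) (ζ k)) *
          (κ ^ 2 * (starRingEnd ℂ) (bilSq ζ)) / R ^ 3) * (ζ j * ζ j) := by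
    intro j
    simp only [sqNormHess, Matrix.of_apply]
    split_ifs <;> ring
  simp_rw [this, Finset.sum_add_distrib, ← Finset.mul_sum, ← hermSq_eq_sum, sum_mul_self, mul_ite,
    mul_zero, Finset.sum_ite_eq, Finset.mem_univ, if_true, sqNormGrad]
  change _ = ζ k + (hermSq ζ * ζ k - κ ^ 2 * bilSq ζ * (starRingEnd ℂ) (ζ k)) / R
  field_simp
  linear_combination (hermSq ζ * ζ k - κ ^ 2 * bilSq ζ * (starRingEnd ℂ) (ζ k)) * hR2

theorem conj_sqNormHess (j k : Fin N) :
    (starRingEnd ℂ) (sqNormHess κ ζ j k) = sqNormHess κ ζ k j := by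
  simp only [sqNormHess, Matrix.of_apply, map_sub, map_add, map_mul, map_div₀, conj_ofReal,
    conj_conj, map_pow, map_ofNat]
  by_cases h : k = j
  · subst h; simp; ring
  · simp [h, Ne.symm h]; ring

theorem sqNormHess_mulVec (h0 : 0 ≤ κ) (h1 : κ < 1) (hζ : ζ ≠ 0) (j : Fin N) :
    ∑ k, sqNormHess κ ζ j k * (starRingEnd ℂ) (ζ k) = (starRingEnd ℂ) (sqNormGrad κ j ζ) := by
  rw [← vecMul_sqNormHess h0 h1 hζ, map_sum]
  refine Finset.sum_congr rfl fun k _ => ?_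
  rw [map_mul, conj_sqNormHess, mul_comm]

/-- Up to the scalar G/R, the Hessian is the identity plus a product UV, where U has the two columns
ζ̄ and ζ. Sylvester's identity det(1 + UV) = det(1 + VU) leaves a 2 × 2 determinant in S, R and
⟨ζ,ζ⟩. -/
theorem det_sqNormHess (h0 : 0 ≤ κ) (h1 : κ < 1) (hζ : ζ ≠ 0) :
    (sqNormHess κ ζ).det = (sqNorm κ ζ / √(radicand κ ζ)) ^ N *
      (hermSq ζ * (1 - κ ^ 2) / √(radicand κ ζ)) := by
  have hR := sqrt_radicand_ne_zero h0 h1 hζ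
  have hR2 := sq_sqrt_radicand h0 h1 ζ
  have hG : (sqNorm κ ζ : ℂ) ≠ 0 := ofReal_ne_zero.2 (sqNorm_pos hζ).ne'
  have hGe : (sqNorm κ ζ : ℂ) = hermSq ζ + √(radicand κ ζ) := by simp [sqNorm]
  set R : ℂ := ((√(radicand κ ζ) : ℝ) : ℂ)
  set G : ℂ := ((sqNorm κ ζ : ℝ) : ℂ)
  set S : ℂ := ((hermSq ζ : ℝ) : ℂ)
  set Q : ℂ := bilSq ζ
  set Q' : ℂ := (starRingEnd ℂ) (bilSq ζ)
  let U : Matrix (Fin N) (Fin 2) ℂ := Matrix.of fun j => ![(starRingEnd ℂ) (ζ j), ζ j]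
  -- The rows collect the coefficients of ζ̄_j and of ζ_j in the Hessian; the factor R/G compensates
  -- the scalar taken out.
  let V : Matrix (Fin 2) (Fin N) ℂ := Matrix.of
    ![fun k => ((1 / R - S ^ 2 / R ^ 3) * ζ k + κ ^ 2 * S * Q / R ^ 3 * (starRingEnd ℂ) (ζ k))
        * (R / G),
      fun k => (κ ^ 2 * S * Q' / R ^ 3 * ζ k - (2 * κ ^ 2 / R + κ ^ 4 * (Q * Q') / R ^ 3) *
        (starRingEnd ℂ) (ζ k)) * (R / G)]
  have hH : sqNormHess κ ζ = (G / R) • (1 + U * V) := by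
    ext j k
    simp only [sqNormHess, Matrix.smul_apply, Matrix.add_apply, Matrix.mul_apply, Fin.sum_univ_two,
      smul_eq_mul, Matrix.one_apply, U, V, Matrix.of_apply, Matrix.cons_val_zero,
      Matrix.cons_val_one]
    change _ + (_ + S * _ - _) / R - (S * ζ k - _ * Q * _) * (S * _ - _ * Q' * _) / R ^ 3 = _
    have e : (G / R) * ((if j = k then 1 else 0)) = (if k = j then 1 + S / R else 0) := by
      rw [hGe]
      by_cases h : j = k
      · subst h; simp; field_simp; ring
      · simp [h, Ne.symm h]
    rw [mul_add, e]
    split_ifs <;> (field_simp; ring)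
  have hVU : V * U = Matrix.of ![
      ![((1 / R - S ^ 2 / R ^ 3) * S + κ ^ 2 * S * Q / R ^ 3 * Q') * (R / G),
        ((1 / R - S ^ 2 / R ^ 3) * Q + κ ^ 2 * S * Q / R ^ 3 * S) * (R / G)],
      ![(κ ^ 2 * S * Q' / R ^ 3 * S - (2 * κ ^ 2 / R + κ ^ 4 * (Q * Q') / R ^ 3) * Q') * (R / G),
        (κ ^ 2 * S * Q' / R ^ 3 * Q - (2 * κ ^ 2 / R + κ ^ 4 * (Q * Q') / R ^ 3) * S) *
          (R / G)]] := by
    have hS : ∑ k, ζ k * (starRingEnd ℂ) (ζ k) = S := (hermSq_eq_sum ζ).symm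
    have hS' : ∑ k, (starRingEnd ℂ) (ζ k) * ζ k = S := sum_conj_mul ζ
    have hQ : ∑ k, ζ k * ζ k = Q := sum_mul_self ζ
    have hQ' : ∑ k, (starRingEnd ℂ) (ζ k) * (starRingEnd ℂ) (ζ k) = Q' := sum_conj_mul_conj ζ
    have gen : ∀ (a b d : ℂ) (x : Fin N → ℂ),
        ∑ k, (a * ζ k + b * (starRingEnd ℂ) (ζ k)) * d * x k =
          (a * ∑ k, ζ k * x k + b * ∑ k, (starRingEnd ℂ) (ζ k) * x k) * d := by
      intro a b d x
      rw [Finset.mul_sum, Finset.mul_sum, ← Finset.sum_add_distrib, Finset.sum_mul]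
      exact Finset.sum_congr rfl fun k _ => by ring
    ext a b
    fin_cases a <;> fin_cases b <;>
      simp [Matrix.mul_apply, U, V, sub_eq_add_neg, ← neg_mul, -neg_add_rev, gen, hS, hS', hQ, hQ']
  rw [hH, Matrix.det_smul, Fintype.card_fin, Matrix.det_one_add_mul_comm, hVU, Matrix.det_fin_two]
  congr 1
  simp only [Matrix.add_apply, Matrix.of_apply, Matrix.cons_val', Matrix.cons_val_zero,
    Matrix.cons_val_one, Matrix.one_apply_eq, Matrix.cons_val_fin_one]
  rw [Matrix.one_apply_ne (by decide), Matrix.one_apply_ne (by decide)]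
  -- The definition of R, and the only relation needed: modulo it the first diagonal entry of VU
  -- vanishes, and the other entries become short.
  have hT : κ ^ 2 * (Q * Q') = S ^ 2 - R ^ 2 := by rw [hR2]; ring
  have e00 : ((1 / R - S ^ 2 / R ^ 3) * S + κ ^ 2 * S * Q / R ^ 3 * Q') * (R / G) = 0 := by
    field_simp
    linear_combination S * hT
  have e10 : (κ ^ 2 * S * Q' / R ^ 3 * S - (2 * κ ^ 2 / R + κ ^ 4 * (Q * Q') / R ^ 3) * Q') *
      (R / G) = - κ ^ 2 * Q' / G := by
    field_simp
    linear_combination (-κ ^ 2 * Q') * hT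
  have e01 : ((1 / R - S ^ 2 / R ^ 3) * Q + κ ^ 2 * S * Q / R ^ 3 * S) * (R / G) =
      κ ^ 2 * Q * (S ^ 2 - Q * Q') / (R ^ 2 * G) := by
    field_simp
    linear_combination Q * hT
  have e11 : (κ ^ 2 * S * Q' / R ^ 3 * Q - (2 * κ ^ 2 / R + κ ^ 4 * (Q * Q') / R ^ 3) * S) *
      (R / G) = S * ((1 + κ ^ 2) * (S ^ 2 - R ^ 2) - 2 * κ ^ 2 * S ^ 2) / (R ^ 2 * G) := by
    field_simp
    linear_combination (S + κ ^ 2 * S) * hT - 2 * κ ^ 2 * S * hT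
  rw [e00, e10, e01, e11]
  have e3 : (0 + κ ^ 2 * Q * (S ^ 2 - Q * Q') / (R ^ 2 * G)) * (0 + -κ ^ 2 * Q' / G) =
      - (S ^ 2 - R ^ 2) * (κ ^ 2 * S ^ 2 - (S ^ 2 - R ^ 2)) / (R ^ 2 * G ^ 2) := by
    rw [← hT]; field_simp; ring
  rw [e3]
  rw [hGe] at hG ⊢
  field_simp
  ring

end Hessian

/-- A Schur complement: `K` has the rows of `D` and, last, the row `x`. -/
theorem det_levi_comp {n : ℕ} (D : Matrix (Fin n) (Fin (n + 1)) ℂ) (x : Fin (n + 1) → ℂ)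
    (H : Matrix (Fin (n + 1)) (Fin (n + 1)) ℂ) (p : Fin (n + 1) → ℂ) (G : ℂ) (hG : G ≠ 0)
    (h1 : ∀ k, ∑ j, x j * H j k = p k)
    (h2 : ∀ j, ∑ k, H j k * (starRingEnd ℂ) (x k) = (starRingEnd ℂ) (p j))
    (h3 : ∑ k, p k * (starRingEnd ℂ) (x k) = G) :
    (D * ((2 * G)⁻¹ • (H - G⁻¹ • vecMulVec (fun j => (starRingEnd ℂ) (p j)) p)) *
      D.conjTranspose).det * (2 ^ n * G ^ (n + 1)) =
      (Matrix.of (Fin.snoc (α := fun _ => Fin (n + 1) → ℂ) (fun j => D j) x)).det * H.det *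
        (starRingEnd ℂ) (Matrix.of (Fin.snoc (α := fun _ => Fin (n + 1) → ℂ) (fun j => D j) x)).det := by
  set K : Matrix (Fin (n + 1)) (Fin (n + 1)) ℂ :=
    Matrix.of (Fin.snoc (α := fun _ => Fin (n + 1) → ℂ) (fun j => D j) x) with hK
  set B : Matrix (Fin n) (Fin 1) ℂ := Matrix.of fun i _ => ∑ j, D i j * (starRingEnd ℂ) (p j)
  set C : Matrix (Fin 1) (Fin n) ℂ := Matrix.of fun _ i => ∑ k, p k * (starRingEnd ℂ) (D i k)
  have hKl : ∀ i, K (Fin.natAdd n i) = x := fun i => by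
    have : Fin.natAdd n i = Fin.last n := by ext; simp
    rw [this]
    change Fin.snoc (α := fun _ => Fin (n + 1) → ℂ) (fun j => D j) x (Fin.last n) = _
    exact Fin.snoc_last _ _
  have hKc : ∀ i, K (Fin.castAdd 1 i) = D i := fun i => by
    change Fin.snoc (α := fun _ => Fin (n + 1) → ℂ) (fun j => D j) x (Fin.castSucc i) = D i
    exact Fin.snoc_castSucc _ _ _
  -- By the Euler relations, bordering with the row x = ζ produces pairings with p and the corner G.
  -- The Schur complement of that corner is D(H - p̄pᵀ/G)D^*, the Levi matrix of the composition up
  -- to the factor 2G.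
  have e1 : (K * H * K.conjTranspose).submatrix finSumFinEquiv finSumFinEquiv =
      fromBlocks (D * H * D.conjTranspose) B C (Matrix.of fun _ _ => G) := by
    ext a b
    rcases a with a | a <;> rcases b with b | b <;>
      simp only [submatrix_apply, finSumFinEquiv_apply_left, finSumFinEquiv_apply_right,
        fromBlocks_apply₁₁, fromBlocks_apply₁₂, fromBlocks_apply₂₁, fromBlocks_apply₂₂, of_apply]
    · simp only [Matrix.mul_apply, conjTranspose_apply, hKc]
    · rw [Matrix.mul_assoc, Matrix.mul_apply]
      refine Finset.sum_congr rfl fun j _ => ?_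
      rw [hKc, ← h2, Matrix.mul_apply]
      simp only [conjTranspose_apply, hKl, starRingEnd_apply]
    · simp only [C, Matrix.mul_apply, conjTranspose_apply, hKc, hKl, of_apply, h1,
        starRingEnd_apply]
    · simp only [Matrix.mul_apply, conjTranspose_apply, hKl, h1]
      exact h3
  have hdetK : (K * H * K.conjTranspose).det = K.det * H.det * (starRingEnd ℂ) K.det := by
    rw [det_mul, det_mul, det_conjTranspose]; rfl
  have hinv : Invertible (Matrix.of fun _ _ => G : Matrix (Fin 1) (Fin 1) ℂ) :=
    ⟨Matrix.of fun _ _ => G⁻¹, by ext i j; simp [Matrix.mul_apply, hG, Matrix.one_apply, Subsingleton.elim i j],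
      by ext i j; simp [Matrix.mul_apply, hG, Matrix.one_apply, Subsingleton.elim i j]⟩
  have hi : ⅟(Matrix.of fun _ _ => G : Matrix (Fin 1) (Fin 1) ℂ) = Matrix.of fun _ _ => G⁻¹ :=
    invOf_eq_right_inv (by
      ext i j; simp [Matrix.mul_apply, hG, Matrix.one_apply, Subsingleton.elim i j])
  have e2 : D * ((2 * G)⁻¹ • (H - G⁻¹ • vecMulVec (fun j => (starRingEnd ℂ) (p j)) p)) *
      D.conjTranspose = (2 * G)⁻¹ • (D * H * D.conjTranspose -
        B * ⅟(Matrix.of fun _ _ => G : Matrix (Fin 1) (Fin 1) ℂ) * C) := by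
    rw [Matrix.mul_smul, Matrix.smul_mul, Matrix.mul_sub, Matrix.sub_mul]
    congr 2
    rw [hi, Matrix.mul_smul, Matrix.smul_mul]
    ext i k
    simp only [Matrix.smul_apply, Matrix.mul_apply, vecMulVec_apply, B, C, of_apply,
      Finset.univ_unique, Finset.sum_singleton, smul_eq_mul, conjTranspose_apply,
      Finset.mul_sum, Finset.sum_mul, starRingEnd_apply]
    refine Finset.sum_congr rfl fun a _ => Finset.sum_congr rfl fun b _ => ?_
    ring
  rw [← hdetK, ← det_submatrix_equiv_self finSumFinEquiv, e1, det_fromBlocks₂₂, e2, det_smul,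
    Fintype.card_fin, det_fin_one, of_apply, inv_pow, mul_pow]
  field_simp
  ring

/-- The density, with respect to Lebesgue measure, of the measure on `ℂ^{n+1}` whose pullback is
`(dd^c (h_ε ∘ Φ))^n ∧ i dz_{n+1} ∧ dz̄_{n+1} / (2|1+z_{n+1}|²)`, with `κ = (1 - ε) / (1 + ε)`. -/
noncomputable def lieDensity (κ : ℝ) (n : ℕ) (ζ : Fin (n + 1) → ℂ) : ℝ :=
  2 ^ n * n.factorial * (1 - κ ^ 2) * hermSq ζ / √(radicand κ ζ) ^ (n + 2)

theorem hermSq_smul {N : ℕ} (a : ℂ) (ζ : Fin N → ℂ) : hermSq (a • ζ) = ‖a‖ ^ 2 * hermSq ζ := by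
  simp [hermSq, mul_pow, Finset.mul_sum]

theorem bilSq_smul {N : ℕ} (a : ℂ) (ζ : Fin N → ℂ) : bilSq (a • ζ) = a ^ 2 * bilSq ζ := by
  simp [bilSq, mul_pow, Finset.mul_sum]

theorem sqrt_radicand_smul {N : ℕ} (κ : ℝ) (a : ℂ) (ζ : Fin N → ℂ) :
    √(radicand κ (a • ζ)) = ‖a‖ ^ 2 * √(radicand κ ζ) := by
  have : radicand κ (a • ζ) = (‖a‖ ^ 2) ^ 2 * radicand κ ζ := by
    rw [radicand, radicand, hermSq_smul, bilSq_smul, norm_mul, norm_pow]; ring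
  rw [this, Real.sqrt_mul (sq_nonneg _), Real.sqrt_sq (sq_nonneg _)]

/-- The degree is |a|² from S against |a|^{2(n+2)} from R^{n+2}. The case R = 0 is harmless because
division by zero gives 0 on both sides. -/
theorem lieDensity_smul {n : ℕ} (κ : ℝ) (a : ℂ) (ha : a ≠ 0) (ζ : Fin (n + 1) → ℂ) :
    lieDensity κ n (a • ζ) * ‖a‖ ^ (2 * n + 2) = lieDensity κ n ζ := by
  have : ‖a‖ ≠ 0 := norm_ne_zero_iff.2 ha
  rw [lieDensity, lieDensity, hermSq_smul, sqrt_radicand_smul]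
  by_cases h : √(radicand κ ζ) = 0
  · simp [h]
  · field_simp
    ring

theorem isOpen_polydisc (m : ℕ) : IsOpen (polydisc m) := by
  simp only [polydisc, Set.ofPred_forall]
  exact isOpen_iInter_of_finite fun j => isOpen_lt (by fun_prop) continuous_const

/-- The Monge-Ampère density of `h_ε ∘ Φ`. -/
theorem mongeAmpere_hReg_comp {n : ℕ} {Φ : (Fin n → ℂ) → (Fin (n + 1) → ℂ)}
    {U : Set (Fin n → ℂ)} (hU : IsOpen U) (hΦ : DifferentiableOn ℂ Φ U) {z : Fin n → ℂ} (hz : z ∈ U)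
    (hz0 : Φ z ≠ 0) {ε : ℝ} (hε : 0 < ε) (hε1 : ε < 1) :
    mongeAmpere (fun w => hReg ε (Φ w)) z =
      (‖(Matrix.of (Fin.snoc (α := fun _ => Fin (n + 1) → ℂ)
        (fun j => fderiv ℂ Φ z (Pi.single j 1)) (Φ z))).det‖ ^ 2 *
          lieDensity ((1 - ε) / (1 + ε)) n (Φ z) : ℝ) := by
  obtain ⟨h0, h1⟩ := kappa_mem hε hε1
  have hlevi := leviMatrix_comp hU hΦ hz
    (Filter.eventually_of_mem (isOpen_ne.mem_nhds hz0) fun w hw => differentiableAt_hReg hε hε1 hw)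
    (differentiableAt_dzbar_hReg hε hε1 hz0)
  rw [leviMatrix_hReg hε hε1 hz0] at hlevi
  set κ := (1 - ε) / (1 + ε)
  have hG : (sqNorm κ (Φ z) : ℂ) ≠ 0 := ofReal_ne_zero.2 (sqNorm_pos hz0).ne'
  have hR := sqrt_radicand_ne_zero h0 h1 hz0
  have hdet := det_levi_comp (Matrix.of fun j l => fderiv ℂ Φ z (Pi.single j 1) l) (Φ z)
    (sqNormHess κ (Φ z)) (fun k => sqNormGrad κ k (Φ z)) (sqNorm κ (Φ z)) hG
    (vecMul_sqNormHess h0 h1 hz0) (sqNormHess_mulVec h0 h1 hz0) (sum_sqNormGrad_mul_conj h0 h1 hz0)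
  rw [← hlevi, det_sqNormHess h0 h1 hz0] at hdet
  have hdet' := eq_div_of_mul_eq (mul_ne_zero (by norm_num) (pow_ne_zero _ hG)) hdet
  rw [mongeAmpere, hdet', lieDensity]
  set K := Matrix.of (Fin.snoc (α := fun _ => Fin (n + 1) → ℂ)
        (fun j => fderiv ℂ Φ z (Pi.single j 1)) (Φ z))
  have hK : (Matrix.of (Fin.snoc (α := fun _ => Fin (n + 1) → ℂ)
    (Matrix.of fun j l => fderiv ℂ Φ z (Pi.single j 1) l) (Φ z))).det = K.det := rfl
  rw [hK]
  have hn : ((‖K.det‖ ^ 2 : ℝ) : ℂ) = K.det * (starRingEnd ℂ) K.det := by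
    rw [mul_conj, normSq_eq_norm_sq]
  rw [ofReal_mul, hn]
  have h4 : (4 : ℂ) ^ n = 2 ^ n * 2 ^ n := by rw [← mul_pow]; norm_num
  rw [h4, div_pow]
  push_cast
  field_simp
  ring

end LieMA

/-! ### The map Φ̃, its Jacobian, and the current as a pullback. -/

namespace LieMA
open Complex Topology Filter Matrix

/-- Holomorphic maps are continuously differentiable by `differentiableAt_fderiv_apply`; strictness
is what the inverse function theorem asks for. -/
theorem hasStrictFDerivAt_of_differentiableOn {m N : ℕ} {F : (Fin m → ℂ) → (Fin N → ℂ)}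
    {U : Set (Fin m → ℂ)} (hU : IsOpen U) (hF : DifferentiableOn ℂ F U) {z : Fin m → ℂ}
    (hz : z ∈ U) : HasStrictFDerivAt F (fderiv ℂ F z) z := by
  refine hasStrictFDerivAt_of_hasFDerivAt_of_continuousAt (f' := fderiv ℂ F) ?_ ?_
  · filter_upwards [hU.mem_nhds hz] with w hw using
      (hF.differentiableAt (hU.mem_nhds hw)).hasFDerivAt
  · have hc : ContinuousOn (fderiv ℂ F) U := by
      refine continuousOn_clm_apply.2 fun v => continuousOn_pi.2 fun l => ?_
      refine ContinuousOn.congr (f := fun w => fderiv ℂ (fun w => F w l) w v)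
        (fun w hw => ?_) fun w hw => ?_
      · exact (differentiableAt_fderiv_apply hU
          (fun w hw => (differentiableWithinAt_pi.1 (hF w hw)) l) hw v).continuousAt.continuousWithinAt
      · change fderiv ℂ F w v l = fderiv ℂ (fun w => F w l) w v
        rw [fderiv_apply (hF.differentiableAt (hU.mem_nhds hw))]; rfl
    exact hc.continuousAt (hU.mem_nhds hz)

section Tilde

variable {n : ℕ} {Φ : (Fin n → ℂ) → (Fin (n + 1) → ℂ)}

theorem init_mem_polydisc {z : Fin (n + 1) → ℂ} (hz : z ∈ polydisc (n + 1)) :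
    (fun j : Fin n => z j.castSucc) ∈ polydisc n := fun j => hz j.castSucc

theorem one_add_last_ne_zero {z : Fin (n + 1) → ℂ} (hz : z ∈ polydisc (n + 1)) :
    1 + z (Fin.last n) ≠ 0 := fun h => by
  have h1 := hz (Fin.last n)
  rw [eq_neg_of_add_eq_zero_right h, norm_neg, norm_one] at h1
  exact lt_irrefl _ h1

theorem tildeMap_ne_zero (hΦ0 : ∀ z ∈ polydisc n, Φ z ≠ 0) {z : Fin (n + 1) → ℂ}
    (hz : z ∈ polydisc (n + 1)) : tildeMap Φ z ≠ 0 :=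
  smul_ne_zero (one_add_last_ne_zero hz) (hΦ0 _ (init_mem_polydisc hz))

theorem hasFDerivAt_tildeMap (hΦ : DifferentiableOn ℂ Φ (polydisc n)) {z : Fin (n + 1) → ℂ}
    (hz : z ∈ polydisc (n + 1)) :
    HasFDerivAt (tildeMap Φ)
      ((1 + z (Fin.last n)) • (fderiv ℂ Φ fun j => z j.castSucc).comp
        (ContinuousLinearMap.pi fun j : Fin n =>
          ContinuousLinearMap.proj (R := ℂ) (φ := fun _ : Fin (n + 1) => ℂ) j.castSucc) +
      (ContinuousLinearMap.proj (R := ℂ) (φ := fun _ : Fin (n + 1) => ℂ)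
        (Fin.last n)).smulRight (Φ fun j => z j.castSucc)) z := by
  have h1 : HasFDerivAt (fun w : Fin (n + 1) → ℂ => fun j : Fin n => w j.castSucc)
      (ContinuousLinearMap.pi fun j : Fin n =>
        ContinuousLinearMap.proj (R := ℂ) (φ := fun _ : Fin (n + 1) => ℂ) j.castSucc) z :=
    (ContinuousLinearMap.pi fun j : Fin n => ContinuousLinearMap.proj (R := ℂ)
      (φ := fun _ : Fin (n + 1) => ℂ) j.castSucc).hasFDerivAt
  have h2 : HasFDerivAt (fun w : Fin (n + 1) → ℂ => 1 + w (Fin.last n))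
      (ContinuousLinearMap.proj (R := ℂ) (φ := fun _ : Fin (n + 1) => ℂ) (Fin.last n)) z :=
    (ContinuousLinearMap.proj (R := ℂ) (φ := fun _ : Fin (n + 1) => ℂ)
      (Fin.last n)).hasFDerivAt.const_add (1 : ℂ)
  exact h2.smul ((hΦ.differentiableAt
    ((isOpen_polydisc n).mem_nhds (init_mem_polydisc hz))).hasFDerivAt.comp z h1)

theorem differentiableOn_tildeMap (hΦ : DifferentiableOn ℂ Φ (polydisc n)) :
    DifferentiableOn ℂ (tildeMap Φ) (polydisc (n + 1)) := fun _ hz =>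
  (hasFDerivAt_tildeMap hΦ hz).differentiableAt.differentiableWithinAt

/-- The partial derivatives of Φ̃ are (1 + z_{n+1})∂_jΦ for j ≤ n, and Φ for the last variable: the
rows of K, n of them scaled. -/
theorem det_fderiv_tildeMap (hΦ : DifferentiableOn ℂ Φ (polydisc n)) {z : Fin (n + 1) → ℂ}
    (hz : z ∈ polydisc (n + 1)) : (fderiv ℂ (tildeMap Φ) z).det =
      (1 + z (Fin.last n)) ^ n * (Matrix.of (Fin.snoc (α := fun _ => Fin (n + 1) → ℂ)
        (fun j => fderiv ℂ Φ (fun j => z j.castSucc) (Pi.single j 1))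
        (Φ fun j => z j.castSucc))).det := by
  set K := Matrix.of (Fin.snoc (α := fun _ => Fin (n + 1) → ℂ)
        (fun j => fderiv ℂ Φ (fun j => z j.castSucc) (Pi.single j 1))
        (Φ fun j => z j.castSucc)) with hK
  have hc : ∀ j, (fun i : Fin n => (Pi.single (M := fun _ => ℂ) (Fin.castSucc j) 1 : Fin (n + 1) → ℂ)
      i.castSucc) = Pi.single j 1 := fun j => by
    funext i; simp [Pi.single_apply]
  have hl : (fun i : Fin n => (Pi.single (M := fun _ => ℂ) (Fin.last n) 1 : Fin (n + 1) → ℂ)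
      i.castSucc) = 0 := by
    funext i; simp [Fin.castSucc_ne_last]
  have hM : (LinearMap.toMatrix' (fderiv ℂ (tildeMap Φ) z : (Fin (n + 1) → ℂ) →ₗ[ℂ] _)).transpose =
      Matrix.diagonal (Fin.snoc (α := fun _ => ℂ) (fun _ : Fin n => 1 + z (Fin.last n)) 1) * K := by
    have hf : ∀ v, fderiv ℂ (tildeMap Φ) z v = (1 + z (Fin.last n)) •
        fderiv ℂ Φ (fun j => z j.castSucc) (fun i => v i.castSucc) +
        v (Fin.last n) • Φ fun j => z j.castSucc := fun v => by
      rw [(hasFDerivAt_tildeMap hΦ hz).fderiv]; rfl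
    have hKl : K (Fin.last n) = Φ fun j => z j.castSucc :=
      Fin.snoc_last (α := fun _ => Fin (n + 1) → ℂ) _
        (fun j => fderiv ℂ Φ (fun j => z j.castSucc) (Pi.single j 1))
    have hKc : ∀ j, K (Fin.castSucc j) = fderiv ℂ Φ (fun j => z j.castSucc) (Pi.single j 1) :=
      fun j => Fin.snoc_castSucc (α := fun _ => Fin (n + 1) → ℂ) _
        (fun j => fderiv ℂ Φ (fun j => z j.castSucc) (Pi.single j 1)) _
    ext i l
    rw [Matrix.transpose_apply, LinearMap.toMatrix'_apply, Matrix.diagonal_mul,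
      ContinuousLinearMap.coe_coe, hf]
    refine Fin.lastCases ?_ (fun j => ?_) i
    · rw [hKl, hl]; simp
    · simp [hKc, hc, Fin.castSucc_ne_last]
  rw [ContinuousLinearMap.det, ← LinearMap.det_toMatrix', ← Matrix.det_transpose, hM, Matrix.det_mul,
    Matrix.det_diagonal, Fin.prod_univ_castSucc]
  simp

/-- The Jacobian contributes |1 + z_{n+1}|^{2n}, the homogeneity of the density |1 +
z_{n+1}|^{-(2n+2)}; the quotient is the weight in the current. -/
theorem mongeAmpere_div_eq (hΦ : DifferentiableOn ℂ Φ (polydisc n))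
    (hΦ0 : ∀ z ∈ polydisc n, Φ z ≠ 0) {z : Fin (n + 1) → ℂ} (hz : z ∈ polydisc (n + 1))
    {ε : ℝ} (hε : 0 < ε) (hε1 : ε < 1) :
    mongeAmpere (fun w => hReg ε (Φ w)) (fun j => z j.castSucc) /
        ((‖1 + z (Fin.last n)‖ ^ 2 : ℝ) : ℂ) =
      (‖(fderiv ℂ (tildeMap Φ) z).det‖ ^ 2 *
        lieDensity ((1 - ε) / (1 + ε)) n (tildeMap Φ z) : ℝ) := by
  have hz' := init_mem_polydisc hz
  have hl := one_add_last_ne_zero hz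
  have hl' : ‖1 + z (Fin.last n)‖ ≠ 0 := norm_ne_zero_iff.2 hl
  rw [mongeAmpere_hReg_comp (isOpen_polydisc n) hΦ hz' (hΦ0 _ hz') hε hε1,
    det_fderiv_tildeMap hΦ hz, ← lieDensity_smul _ _ hl, ← ofReal_div]
  congr 1
  rw [norm_mul, norm_pow, tildeMap]
  field_simp
  ring

end Tilde
end LieMA

/-! ### A radial integral, and real coordinates on ℂ^N. -/

namespace LieMA
open Complex Topology Filter MeasureTheory Set

section Japanese

variable (n : ℕ)

theorem integrable_inv_sqrt_one_add_pow :
    Integrable (fun u : EuclideanSpace ℝ (Fin n) => (√(1 + ‖u‖ ^ 2) ^ (n + 2))⁻¹) := by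
  have h := integrable_rpow_neg_one_add_norm_sq (E := EuclideanSpace ℝ (Fin n)) (μ := volume)
    (r := n + 2) (by simp)
  refine h.congr (.of_forall fun u => ?_)
  have : (0 : ℝ) ≤ 1 + ‖u‖ ^ 2 := by positivity
  simp only
  rw [Real.sqrt_eq_rpow, ← Real.rpow_natCast (_ ^ (1 / 2 : ℝ)) (n + 2), ← Real.rpow_mul this,
    ← Real.rpow_neg this]
  congr 1
  push_cast; ring

/-- In polar coordinates the integrand n r^{n-1}(1 + r²)^{-(n+2)/2} is the derivative of (r/(1 +
r²)^{1/2})^n, which increases from 0 to 1. Only the volume of the ball remains. -/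
theorem integral_inv_sqrt_one_add_pow :
    ∫ u : EuclideanSpace ℝ (Fin n), (√(1 + ‖u‖ ^ 2) ^ (n + 2))⁻¹ = ballVol n := by
  -- Polar coordinates need a nontrivial space, so the one-point space is treated apart.
  rcases Nat.eq_zero_or_pos n with rfl | hn
  · have h1 : (fun u : EuclideanSpace ℝ (Fin 0) => (√(1 + ‖u‖ ^ 2) ^ (0 + 2))⁻¹) = fun _ => 1 := by
      funext u; rw [Subsingleton.elim u 0]; simp
    have h2 : Metric.ball (0 : EuclideanSpace ℝ (Fin 0)) 1 = univ := by
      ext u; rw [Subsingleton.elim u 0]; simp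
    rw [h1, integral_const, ballVol, h2, smul_eq_mul, mul_one, Measure.real]
  have : Nonempty (Fin n) := ⟨⟨0, hn⟩⟩
  rw [integral_fun_norm_addHaar volume (fun r : ℝ => (√(1 + r ^ 2) ^ (n + 2))⁻¹),
    finrank_euclideanSpace_fin]
  have hpos : ∀ r : ℝ, 0 < 1 + r ^ 2 := fun r => by positivity
  have hsq : ∀ r : ℝ, √(1 + r ^ 2) ^ 2 = 1 + r ^ 2 := fun r => Real.sq_sqrt (hpos r).le
  have hd : ∀ r ∈ Ici (0 : ℝ), HasDerivAt (fun r => (r / √(1 + r ^ 2)) ^ n)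
      (n * (r ^ (n - 1) • (√(1 + r ^ 2) ^ (n + 2))⁻¹)) r := by
    intro r _
    have h1 : HasDerivAt (fun r : ℝ => √(1 + r ^ 2)) (r / √(1 + r ^ 2)) r := by
      have := ((hasDerivAt_pow 2 r).const_add 1).sqrt (hpos r).ne'
      refine this.congr_deriv ?_
      field_simp
      simp
    have h2 := ((hasDerivAt_id r).div h1 (Real.sqrt_pos.2 (hpos r)).ne').pow n
    refine h2.congr_deriv ?_
    have hs : √(1 + r ^ 2) ≠ 0 := (Real.sqrt_pos.2 (hpos r)).ne'
    have h3 : (1 * √(1 + r ^ 2) - id r * (r / √(1 + r ^ 2))) / √(1 + r ^ 2) ^ 2 =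
        (√(1 + r ^ 2) ^ 3)⁻¹ := by
      simp only [id]
      field_simp
      rw [hsq]; ring
    rw [h3]
    simp only [id, Pi.div_apply, smul_eq_mul]
    obtain ⟨k, rfl⟩ : ∃ k, n = k + 1 := ⟨n - 1, by omega⟩
    simp only [Nat.add_sub_cancel]
    rw [div_pow]
    field_simp
    ring
  have hint : IntegrableOn (fun r : ℝ => n * (r ^ (n - 1) • (√(1 + r ^ 2) ^ (n + 2))⁻¹)) (Ioi 0) := by
    have := (integrable_fun_norm_addHaar (E := EuclideanSpace ℝ (Fin n)) volume
      (f := fun r : ℝ => (√(1 + r ^ 2) ^ (n + 2))⁻¹)).1 (integrable_inv_sqrt_one_add_pow n)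
    rw [finrank_euclideanSpace_fin] at this
    exact this.const_mul _
  have hlim : Tendsto (fun r : ℝ => (r / √(1 + r ^ 2)) ^ n) atTop (𝓝 1) := by
    have h1 : Tendsto (fun r : ℝ => 1 / √((r ^ 2)⁻¹ + 1)) atTop (𝓝 (1 / √(0 + 1))) := by
      refine Tendsto.div tendsto_const_nhds (Tendsto.sqrt (Tendsto.add_const _ ?_)) (by simp)
      exact tendsto_inv_atTop_zero.comp (tendsto_pow_atTop two_ne_zero)
    have h2 : Tendsto (fun r : ℝ => r / √(1 + r ^ 2)) atTop (𝓝 1) := by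
      refine Tendsto.congr' ?_ (by simpa using h1)
      filter_upwards [eventually_gt_atTop 0] with r hr
      have : (r ^ 2)⁻¹ + 1 = (1 + r ^ 2) / r ^ 2 := by field_simp
      rw [this, Real.sqrt_div (hpos r).le, Real.sqrt_sq hr.le]
      simp
    simpa using h2.pow n
  have := integral_Ioi_of_hasDerivAt_of_tendsto' hd hint hlim
  rw [integral_const_mul] at this
  simp only [zero_div, ne_eq, hn.ne', not_false_eq_true, zero_pow, sub_zero] at this
  rw [nsmul_eq_mul, smul_eq_mul, mul_left_comm, this, mul_one, ballVol, Measure.real]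

variable {n}

theorem inv_sqrt_pow_eq {b c : ℝ} (hb : 0 < b) (hc : 0 < c) (u : EuclideanSpace ℝ (Fin n)) :
    (√(c ^ 2 + b ^ 2 * ‖u‖ ^ 2) ^ (n + 2))⁻¹ =
      (c ^ (n + 2))⁻¹ * (√(1 + ‖(b / c) • u‖ ^ 2) ^ (n + 2))⁻¹ := by
  have h : c ^ 2 + b ^ 2 * ‖u‖ ^ 2 = c ^ 2 * (1 + ‖(b / c) • u‖ ^ 2) := by
    rw [norm_smul, Real.norm_of_nonneg (by positivity)]
    field_simp
  rw [h, Real.sqrt_mul (sq_nonneg _), Real.sqrt_sq hc.le, mul_pow, mul_inv]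

theorem integrable_inv_sqrt_pow {b c : ℝ} (hb : 0 < b) (hc : 0 < c) :
    Integrable (fun u : EuclideanSpace ℝ (Fin n) => (√(c ^ 2 + b ^ 2 * ‖u‖ ^ 2) ^ (n + 2))⁻¹) := by
  simp_rw [inv_sqrt_pow_eq hb hc]
  exact ((integrable_inv_sqrt_one_add_pow n).comp_smul (by positivity)).const_mul _

theorem integral_inv_sqrt_pow {b c : ℝ} (hb : 0 < b) (hc : 0 < c) :
    ∫ u : EuclideanSpace ℝ (Fin n), (√(c ^ 2 + b ^ 2 * ‖u‖ ^ 2) ^ (n + 2))⁻¹ =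
      ballVol n / (c ^ 2 * b ^ n) := by
  simp_rw [inv_sqrt_pow_eq hb hc]
  rw [integral_const_mul, Measure.integral_comp_smul volume
    (fun u : EuclideanSpace ℝ (Fin n) => (√(1 + ‖u‖ ^ 2) ^ (n + 2))⁻¹),
    integral_inv_sqrt_one_add_pow, finrank_euclideanSpace_fin, abs_of_pos (by positivity),
    smul_eq_mul, div_pow]
  field_simp
  ring

end Japanese

section Coordinates

/-- The point `y + ia` of `ℂ^N`. -/
noncomputable def cplx {N : ℕ} (p : EuclideanSpace ℝ (Fin N) × EuclideanSpace ℝ (Fin N)) :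
    Fin N → ℂ := fun j => (p.1 j : ℂ) + p.2 j * I

theorem continuous_cplx {N : ℕ} : Continuous (cplx (N := N)) := by
  unfold cplx; fun_prop

variable {N : ℕ}

theorem hermSq_cplx (y a : EuclideanSpace ℝ (Fin N)) :
    hermSq (cplx (y, a)) = ‖y‖ ^ 2 + ‖a‖ ^ 2 := by
  simp only [hermSq, cplx, EuclideanSpace.norm_sq_eq, ← Finset.sum_add_distrib]
  refine Finset.sum_congr rfl fun j _ => ?_
  rw [← normSq_eq_norm_sq, normSq_add_mul_I]
  simp

theorem bilSq_cplx (y a : EuclideanSpace ℝ (Fin N)) :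
    bilSq (cplx (y, a)) = ((‖y‖ ^ 2 - ‖a‖ ^ 2 : ℝ) : ℂ) + ((2 * inner ℝ y a : ℝ) : ℂ) * I := by
  simp only [bilSq, cplx, EuclideanSpace.norm_sq_eq, PiLp.inner_apply, Finset.mul_sum]
  push_cast
  rw [Finset.sum_mul, ← Finset.sum_sub_distrib, ← Finset.sum_add_distrib]
  refine Finset.sum_congr rfl fun j _ => ?_
  have h : ∀ x : ℝ, ((‖x‖ : ℝ) : ℂ) ^ 2 = (x : ℂ) ^ 2 := fun x => by
    rw [← ofReal_pow, Real.norm_eq_abs, sq_abs, ofReal_pow]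
  rw [h, h]
  simp
  linear_combination (a j : ℂ) ^ 2 * I_sq

/-- The second summand is 4κ² times the Gram determinant of y and a. At κ = 1 it alone remains, so
the density degenerates exactly along ℂℝ^N. -/
theorem radicand_cplx (κ : ℝ) (y a : EuclideanSpace ℝ (Fin N)) :
    radicand κ (cplx (y, a)) = (1 - κ ^ 2) * (‖y‖ ^ 2 + ‖a‖ ^ 2) ^ 2 +
      4 * κ ^ 2 * (‖y‖ ^ 2 * ‖a‖ ^ 2 - inner ℝ y a ^ 2) := by
  rw [radicand, hermSq_cplx, bilSq_cplx, ← normSq_eq_norm_sq, normSq_add_mul_I]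
  ring

theorem measurePreserving_cplx : MeasurePreserving (cplx (N := N)) ∧
    MeasurableEmbedding (cplx (N := N)) := by
  let e1 : (Fin N → ℂ) ≃ᵐ (Fin N → ℝ × ℝ) :=
    MeasurableEquiv.piCongrRight fun _ => measurableEquivRealProd
  let e2 : (Fin N → ℝ × ℝ) ≃ᵐ (Fin N → ℝ) × (Fin N → ℝ) :=
    MeasurableEquiv.arrowProdEquivProdArrow ℝ ℝ (Fin N)
  let e3 : EuclideanSpace ℝ (Fin N) × EuclideanSpace ℝ (Fin N) ≃ᵐ (Fin N → ℝ) × (Fin N → ℝ) :=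
    (MeasurableEquiv.toLp 2 (Fin N → ℝ)).symm.prodCongr (MeasurableEquiv.toLp 2 (Fin N → ℝ)).symm
  have h1 : MeasurePreserving e1 :=
    volume_preserving_pi fun _ => volume_preserving_equiv_real_prod
  have h2 : MeasurePreserving e2 := volume_measurePreserving_arrowProdEquivProdArrow _ _ _
  have h3 : MeasurePreserving e3 :=
    (PiLp.volume_preserving_ofLp (Fin N)).prod (PiLp.volume_preserving_ofLp (Fin N))
  have he : cplx (N := N) = (e3.trans (e2.symm.trans e1.symm)) := by
    funext p j
    apply Complex.ext <;> simp [cplx, e1, e2, e3] <;> rfl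
  rw [he]
  exact ⟨h3.trans (h2.symm.trans h1.symm), MeasurableEquiv.measurableEmbedding _⟩

/-- Orthogonal coordinates adapted to a nonzero vector `a`. -/
theorem exists_adapted_coordinates {n : ℕ} {a : EuclideanSpace ℝ (Fin (n + 1))} (ha : a ≠ 0) :
    ∃ T : ℝ × EuclideanSpace ℝ (Fin n) ≃ᵐ EuclideanSpace ℝ (Fin (n + 1)),
      MeasurePreserving T ∧ Continuous T ∧ (∀ τ w, ‖T (τ, w)‖ ^ 2 = τ ^ 2 + ‖w‖ ^ 2) ∧
      (∀ τ w, inner ℝ (T (τ, w)) a = τ * ‖a‖) ∧ ∀ τ, T (τ, 0) = (τ / ‖a‖) • a := by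
  have ha' : ‖a‖ ≠ 0 := norm_ne_zero_iff.2 ha
  obtain ⟨b, hb⟩ : ∃ b : OrthonormalBasis (Fin (n + 1)) ℝ (EuclideanSpace ℝ (Fin (n + 1))),
      b 0 = ‖a‖⁻¹ • a := by
    have ho : Orthonormal ℝ (({0} : Set (Fin (n + 1))).domRestrict fun _ => ‖a‖⁻¹ • a) := by
      refine ⟨fun i => ?_, fun i j hij => absurd (Subsingleton.elim i j) hij⟩
      simp [norm_smul, ha']
    obtain ⟨b, hb⟩ := ho.exists_orthonormalBasis_extension_of_card_eq (by simp)
    exact ⟨b, hb 0 rfl⟩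
  let e1 : ℝ × EuclideanSpace ℝ (Fin n) ≃ᵐ ℝ × (Fin n → ℝ) :=
    (MeasurableEquiv.refl ℝ).prodCongr (MeasurableEquiv.toLp 2 (Fin n → ℝ)).symm
  let e2 : (Fin (n + 1) → ℝ) ≃ᵐ ℝ × (Fin n → ℝ) :=
    MeasurableEquiv.piFinSuccAbove (fun _ => ℝ) 0
  let e3 : (Fin (n + 1) → ℝ) ≃ᵐ EuclideanSpace ℝ (Fin (n + 1)) := MeasurableEquiv.toLp 2 _
  let e4 : EuclideanSpace ℝ (Fin (n + 1)) ≃ᵐ EuclideanSpace ℝ (Fin (n + 1)) :=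
    b.repr.symm.toMeasurableEquiv
  have h1 : MeasurePreserving e1 :=
    (MeasurePreserving.id volume).prod (PiLp.volume_preserving_ofLp (Fin n))
  have h2 : MeasurePreserving e2 := volume_preserving_piFinSuccAbove (fun _ => ℝ) 0
  have h3 : MeasurePreserving e3 := PiLp.volume_preserving_toLp (Fin (n + 1))
  have h4 : MeasurePreserving e4 := b.repr.symm.measurePreserving
  have hT : ∀ τ w, (((e1.trans e2.symm).trans e3).trans e4) (τ, w) =
      b.repr.symm (WithLp.toLp 2 (Fin.cons τ (WithLp.ofLp w))) := by
    intro τ w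
    change b.repr.symm (WithLp.toLp 2 (Fin.insertNth 0 τ (WithLp.ofLp w))) = _
    rw [Fin.insertNth_zero]
    rfl
  have hsum : ∀ τ (w : EuclideanSpace ℝ (Fin n)),
      b.repr.symm (WithLp.toLp 2 (Fin.cons τ (WithLp.ofLp w))) =
        τ • b 0 + ∑ i : Fin n, w i • b i.succ := by
    intro τ w
    rw [← b.sum_repr_symm]
    simp [Fin.sum_univ_succ]
  refine ⟨((e1.trans e2.symm).trans e3).trans e4, ((h1.trans h2.symm).trans h3).trans h4, ?_,
    fun τ w => ?_, fun τ w => ?_, fun τ => ?_⟩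
  · have : ⇑(((e1.trans e2.symm).trans e3).trans e4) = fun p : ℝ × EuclideanSpace ℝ (Fin n) =>
      p.1 • b 0 + ∑ i : Fin n, p.2 i • b i.succ := by
      funext p; rw [← hsum, ← hT]
    rw [this]; fun_prop
  · rw [hT, LinearIsometryEquiv.norm_map, EuclideanSpace.norm_sq_eq, Fin.sum_univ_succ,
      EuclideanSpace.norm_sq_eq]
    simp
  · have : a = ‖a‖ • b 0 := by rw [hb, smul_smul, mul_inv_cancel₀ ha', one_smul]
    conv_lhs => rw [this]
    rw [inner_smul_right, real_inner_comm, ← b.repr_apply_apply, hT, LinearIsometryEquiv.apply_symm_apply]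
    simp [mul_comm]
  · rw [hT, hsum, hb, smul_smul]
    simp [div_eq_mul_inv]

end Coordinates
end LieMA

/-! ### The limit κ → 1 of the densities, slice by slice. -/

namespace LieMA
open Complex Topology Filter MeasureTheory Set

/-- Continuous functions with compact support in `ℂ^N ∖ {0}`. -/
structure IsAdmissible {N : ℕ} (ψ : (Fin N → ℂ) → ℂ) : Prop where
  continuous : Continuous ψ
  hasCompactSupport : HasCompactSupport ψ
  zero_notMem : (0 : Fin N → ℂ) ∉ tsupport ψ

namespace IsAdmissible

variable {N : ℕ} {ψ : (Fin N → ℂ) → ℂ}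

theorem exists_bounds (h : IsAdmissible ψ) : ∃ m M C : ℝ, 0 < m ∧ 0 < M ∧ 0 < C ∧
    (∀ ζ, ‖ψ ζ‖ ≤ C) ∧ ∀ ζ, ψ ζ ≠ 0 → m ≤ hermSq ζ ∧ hermSq ζ ≤ M := by
  obtain ⟨C, hC⟩ := h.hasCompactSupport.exists_bound_of_continuous h.continuous
  have hcont : ContinuousOn hermSq (tsupport ψ) := differentiable_hermSq.continuous.continuousOn
  have hK : IsCompact (tsupport ψ) := h.hasCompactSupport
  obtain ⟨M, hM⟩ := hK.exists_bound_of_continuousOn hcont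
  obtain ⟨m, hm, hm'⟩ : ∃ m : ℝ, 0 < m ∧ ∀ ζ ∈ tsupport ψ, m ≤ hermSq ζ :=
    hK.exists_forall_le' hcont fun ζ hζ => hermSq_pos fun h0 => h.zero_notMem (h0 ▸ hζ)
  refine ⟨m, max M 1, max C 1, hm, by positivity, by positivity,
    fun ζ => (hC ζ).trans (le_max_left _ _), fun ζ hζ => ?_⟩
  have hmem : ζ ∈ tsupport ψ := subset_tsupport _ hζ
  exact ⟨hm' ζ hmem, ((le_abs_self _).trans (hM ζ hmem)).trans (le_max_left _ _)⟩

/-- The support of ψ stays away from 0, so continuity of g off the origin suffices. -/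
theorem continuous_mul (h : IsAdmissible ψ) {g : (Fin N → ℂ) → ℂ}
    (hg : ∀ ζ, ζ ≠ 0 → ContinuousAt g ζ) : Continuous fun ζ => ψ ζ * g ζ := by
  refine continuous_iff_continuousAt.2 fun ζ => ?_
  by_cases hζ : ζ = 0
  · have h0 : ζ ∉ tsupport ψ := hζ ▸ h.zero_notMem
    have : (fun ζ => ψ ζ * g ζ) =ᶠ[𝓝 ζ] fun _ => 0 := by
      filter_upwards [notMem_tsupport_iff_eventuallyEq.1 h0] with w hw
      simp [hw]
    exact continuousAt_const.congr this.symm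
  · exact h.continuous.continuousAt.mul (hg ζ hζ)

end IsAdmissible

theorem continuousAt_lieDensity {κ : ℝ} (h0 : 0 ≤ κ) (h1 : κ < 1) {n : ℕ} {ζ : Fin (n + 1) → ℂ}
    (hζ : ζ ≠ 0) : ContinuousAt (fun ζ => (lieDensity κ n ζ : ℂ)) ζ := by
  refine continuous_ofReal.continuousAt.comp (f := lieDensity κ n) ?_
  have hS : ContinuousAt (hermSq (N := n + 1)) ζ := (differentiable_hermSq ζ).continuousAt
  have hR := (differentiableAt_sqrt_radicand h0 h1 hζ).continuousAt
  refine ContinuousAt.div (continuousAt_const.mul hS) (hR.pow _) ?_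
  exact pow_ne_zero _ (Real.sqrt_pos.2 (radicand_pos h0 h1 hζ)).ne'

theorem IsAdmissible.continuous_mul_lieDensity {n : ℕ} {ψ : (Fin (n + 1) → ℂ) → ℂ}
    (h : IsAdmissible ψ) {κ : ℝ} (h0 : 0 ≤ κ) (h1 : κ < 1) :
    Continuous fun ζ => ψ ζ * (lieDensity κ n ζ : ℂ) :=
  h.continuous_mul fun _ hζ => continuousAt_lieDensity h0 h1 hζ

theorem IsAdmissible.integrable_mul_lieDensity {n : ℕ} {ψ : (Fin (n + 1) → ℂ) → ℂ}
    (h : IsAdmissible ψ) {κ : ℝ} (h0 : 0 ≤ κ) (h1 : κ < 1) :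
    Integrable fun ζ => ψ ζ * (lieDensity κ n ζ : ℂ) :=
  (h.continuous_mul_lieDensity h0 h1).integrable_of_hasCompactSupport
    (h.hasCompactSupport.mul_right)

section Fiber

variable {n : ℕ}

/-- The density in adapted coordinates, after the rescaling by `(1 - κ²)^{1/2}` of the directions
transversal to `ℂℝ^{n+1}`; here `s = |ζ|²` and `r` is the norm of the transversal variable. -/
noncomputable def fiberDensity (n : ℕ) (κ α s r : ℝ) : ℝ :=
  2 ^ n * n.factorial * s * (√(s ^ 2 + (2 * κ * α) ^ 2 * r ^ 2) ^ (n + 2))⁻¹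

/-- A majorant independent of κ, integrable in u when α > 0: κ ≥ 1/2 gives 2κα ≥ α. -/
theorem fiberDensity_le {κ α m M s r : ℝ} (hκ : 1 / 2 ≤ κ) (hα : 0 ≤ α) (hm : 0 < m)
    (h1 : m ≤ s) (h2 : s ≤ M) :
    fiberDensity n κ α s r ≤
      2 ^ n * n.factorial * M * (√(m ^ 2 + α ^ 2 * r ^ 2) ^ (n + 2))⁻¹ := by
  have h3 : α ^ 2 ≤ (2 * κ * α) ^ 2 := pow_le_pow_left₀ hα (by nlinarith) 2
  have h4 : 0 < √(m ^ 2 + α ^ 2 * r ^ 2) := Real.sqrt_pos.2 (by positivity)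
  have h5 : m ^ 2 ≤ s ^ 2 := pow_le_pow_left₀ hm.le h1 2
  have h6 : 0 < M := hm.trans_le (h1.trans h2)
  unfold fiberDensity
  gcongr

theorem fiberDensity_nonneg {κ α s r : ℝ} (hs : 0 ≤ s) : 0 ≤ fiberDensity n κ α s r := by
  unfold fiberDensity; positivity

/-- With transversal component of length (1 - κ²)^{1/2}r, the Gram determinant is (1 - κ²)|a|²r².
The root thus carries a factor (1 - κ²)^{1/2}, and its power n + 2 is compensated by the numerator 1
- κ² and the Jacobian (1 - κ²)^{n/2}. -/
theorem lieDensity_cplx_rescaled {κ : ℝ} (h0 : 0 ≤ κ) (h1 : κ < 1)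
    {y a : EuclideanSpace ℝ (Fin (n + 1))} {τ r : ℝ}
    (hy : ‖y‖ ^ 2 = τ ^ 2 + (√(1 - κ ^ 2) * r) ^ 2) (hya : inner ℝ y a = τ * ‖a‖) :
    lieDensity κ n (cplx (y, a)) * √(1 - κ ^ 2) ^ n =
      fiberDensity n κ ‖a‖ (hermSq (cplx (y, a))) r := by
  have hδ : 0 < 1 - κ ^ 2 := by nlinarith
  have hs : 0 < √(1 - κ ^ 2) := Real.sqrt_pos.2 hδ
  have hsq : √(1 - κ ^ 2) ^ 2 = 1 - κ ^ 2 := Real.sq_sqrt hδ.le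
  have hr : √(radicand κ (cplx (y, a))) = √(1 - κ ^ 2) *
      √(hermSq (cplx (y, a)) ^ 2 + (2 * κ * ‖a‖) ^ 2 * r ^ 2) := by
    rw [← Real.sqrt_mul hδ.le, radicand_cplx, hermSq_cplx, hya, hy]
    congr 1
    rw [mul_pow, hsq]
    ring
  rw [lieDensity, fiberDensity, hr]
  generalize √(hermSq (cplx (y, a)) ^ 2 + (2 * κ * ‖a‖) ^ 2 * r ^ 2) = R
  generalize hermSq (cplx (y, a)) = S
  rw [← hsq]
  generalize √(1 - κ ^ 2) = d at hs
  rw [Real.sqrt_sq hs.le, mul_pow, pow_add d, div_eq_mul_inv, mul_inv, mul_inv]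
  field_simp

variable {ψ : (Fin (n + 1) → ℂ) → ℂ} {a : EuclideanSpace ℝ (Fin (n + 1))}
  {T : ℝ × EuclideanSpace ℝ (Fin n) ≃ᵐ EuclideanSpace ℝ (Fin (n + 1))}

/-- The integrand in adapted, rescaled coordinates. -/
noncomputable def fiberIntegrand (ψ : (Fin (n + 1) → ℂ) → ℂ) (a : EuclideanSpace ℝ (Fin (n + 1)))
    (T : ℝ × EuclideanSpace ℝ (Fin n) → EuclideanSpace ℝ (Fin (n + 1))) (κ τ : ℝ)
    (u : EuclideanSpace ℝ (Fin n)) : ℂ :=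
  ψ (cplx (T (τ, √(1 - κ ^ 2) • u), a)) *
    (fiberDensity n κ ‖a‖ (hermSq (cplx (T (τ, √(1 - κ ^ 2) • u), a))) ‖u‖ : ℂ)

/-- After rescaling nothing is singular at κ = 1. Continuity holds for all real κ, since `Real.sqrt`
is 0 on negative numbers, so the limit is a value at κ = 1. -/
theorem continuous_fiberIntegrand (hψ : IsAdmissible ψ) (ha : a ≠ 0) (hT : Continuous T) :
    Continuous fun p : ℝ × ℝ × EuclideanSpace ℝ (Fin n) =>
      fiberIntegrand ψ a T p.1 p.2.1 p.2.2 := by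
  have hz : Continuous fun p : ℝ × ℝ × EuclideanSpace ℝ (Fin n) =>
      cplx (T (p.2.1, √(1 - p.1 ^ 2) • p.2.2), a) :=
    continuous_cplx.comp ((hT.comp (by fun_prop)).prodMk continuous_const)
  have hs := differentiable_hermSq.continuous.comp hz
  unfold fiberIntegrand fiberDensity
  refine (hψ.continuous.comp hz).mul (continuous_ofReal.comp ?_)
  refine (continuous_const.mul hs).mul (Continuous.inv₀ ?_ fun p => ?_)
  · refine Continuous.pow (Continuous.sqrt ?_) _
    exact (hs.pow 2).add (by fun_prop)
  · refine pow_ne_zero _ (Real.sqrt_pos.2 ?_).ne'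
    rw [hermSq_cplx]
    have : 0 < ‖a‖ := norm_pos_iff.2 ha
    positivity

theorem norm_fiberIntegrand_le {m M C : ℝ} (hm : 0 < m) (hM : 0 < M) (hC : 0 < C)
    (hψC : ∀ ζ, ‖ψ ζ‖ ≤ C) (hψs : ∀ ζ, ψ ζ ≠ 0 → m ≤ hermSq ζ ∧ hermSq ζ ≤ M)
    (hTn : ∀ τ w, ‖T (τ, w)‖ ^ 2 = τ ^ 2 + ‖w‖ ^ 2) {κ : ℝ} (hκ : 1 / 2 ≤ κ) (τ : ℝ)
    (u : EuclideanSpace ℝ (Fin n)) :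
    ‖fiberIntegrand ψ a T κ τ u‖ ≤ (Metric.closedBall (0 : EuclideanSpace ℝ (Fin (n + 1))) √M).indicator
      (fun _ => (Icc (-√M) √M).indicator (fun _ => C * (2 ^ n * n.factorial * M *
        (√(m ^ 2 + ‖a‖ ^ 2 * ‖u‖ ^ 2) ^ (n + 2))⁻¹)) τ) a := by
  have hnn : 0 ≤ C * (2 ^ n * n.factorial * M * (√(m ^ 2 + ‖a‖ ^ 2 * ‖u‖ ^ 2) ^ (n + 2))⁻¹) := by
    positivity
  by_cases h : ψ (cplx (T (τ, √(1 - κ ^ 2) • u), a)) = 0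
  · rw [fiberIntegrand, h, zero_mul, norm_zero]
    exact indicator_nonneg (fun _ _ => indicator_nonneg (fun _ _ => hnn) _) _
  obtain ⟨h1, h2⟩ := hψs _ h
  have h3 : hermSq (cplx (T (τ, √(1 - κ ^ 2) • u), a)) =
      τ ^ 2 + ‖√(1 - κ ^ 2) • u‖ ^ 2 + ‖a‖ ^ 2 := by rw [hermSq_cplx, hTn]
  have hτ : τ ∈ Icc (-√M) √M := by
    refine abs_le.1 (Real.abs_le_sqrt ?_)
    nlinarith [sq_nonneg ‖√(1 - κ ^ 2) • u‖, sq_nonneg ‖a‖]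
  have ha : a ∈ Metric.closedBall (0 : EuclideanSpace ℝ (Fin (n + 1))) √M := by
    rw [mem_closedBall_zero_iff]
    refine Real.le_sqrt_of_sq_le ?_
    nlinarith [sq_nonneg ‖√(1 - κ ^ 2) • u‖, sq_nonneg τ]
  rw [indicator_of_mem ha, indicator_of_mem hτ, fiberIntegrand, norm_mul, norm_real,
    Real.norm_of_nonneg (fiberDensity_nonneg (hm.le.trans h1))]
  exact mul_le_mul (hψC _) (fiberDensity_le hκ (norm_nonneg _) hm h1 h2)
    (fiberDensity_nonneg (hm.le.trans h1)) hC.le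

theorem hasCompactSupport_slice (hψ : IsAdmissible ψ) (g : (Fin (n + 1) → ℂ) → ℂ)
    (a : EuclideanSpace ℝ (Fin (n + 1))) :
    HasCompactSupport fun y : EuclideanSpace ℝ (Fin (n + 1)) =>
      ψ (cplx (y, a)) * g (cplx (y, a)) := by
  obtain ⟨m, M, C, hm, hM, hC, hψC, hψs⟩ := hψ.exists_bounds
  refine HasCompactSupport.intro (isCompact_closedBall 0 √M) fun y hy => ?_
  by_contra h
  refine hy ?_
  have := (hψs _ (left_ne_zero_of_mul h)).2
  rw [hermSq_cplx] at this
  rw [mem_closedBall_zero_iff]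
  exact Real.le_sqrt_of_sq_le (by nlinarith [sq_nonneg ‖a‖])

theorem integral_slice_eq (hψ : IsAdmissible ψ) (hTm : MeasurePreserving T)
    (hTn : ∀ τ w, ‖T (τ, w)‖ ^ 2 = τ ^ 2 + ‖w‖ ^ 2)
    (hTa : ∀ τ w, inner ℝ (T (τ, w)) a = τ * ‖a‖) {κ : ℝ} (h0 : 0 ≤ κ) (h1 : κ < 1) :
    ∫ y, ψ (cplx (y, a)) * (lieDensity κ n (cplx (y, a)) : ℂ) =
      ∫ τ, ∫ u, fiberIntegrand ψ a T κ τ u := by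
  have hcont : Continuous fun y : EuclideanSpace ℝ (Fin (n + 1)) =>
      ψ (cplx (y, a)) * (lieDensity κ n (cplx (y, a)) : ℂ) :=
    (hψ.continuous_mul_lieDensity h0 h1).comp
      (continuous_cplx.comp (continuous_id.prodMk continuous_const))
  have hint := hcont.integrable_of_hasCompactSupport (μ := volume)
    (hasCompactSupport_slice hψ (fun ζ => (lieDensity κ n ζ : ℂ)) a)
  rw [← hTm.integral_comp' (g := fun y => ψ (cplx (y, a)) * (lieDensity κ n (cplx (y, a)) : ℂ))]
  have hint' := (hTm.integrable_comp_emb T.measurableEmbedding).2 hint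
  rw [Measure.volume_eq_prod] at hint' ⊢
  refine (integral_prod _ hint').trans ?_
  have hδ : 0 < √(1 - κ ^ 2) := Real.sqrt_pos.2 (by nlinarith)
  congr 1
  funext τ
  have := Measure.integral_comp_smul volume (fun w : EuclideanSpace ℝ (Fin n) =>
    ψ (cplx (T (τ, w), a)) * (lieDensity κ n (cplx (T (τ, w), a)) : ℂ)) √(1 - κ ^ 2)
  rw [finrank_euclideanSpace_fin, abs_of_pos (by positivity), eq_inv_smul_iff₀ (by positivity),
    ← integral_smul] at this
  refine this.symm.trans ?_
  congr 1
  funext u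
  rw [fiberIntegrand, ← lieDensity_cplx_rescaled h0 h1 (r := ‖u‖) (τ := τ) _ (hTa _ _)]
  · rw [real_smul]; push_cast; ring
  · rw [hTn, norm_smul, Real.norm_of_nonneg hδ.le]

/-- At κ = 1 the transversal variable no longer enters ψ, which is evaluated on ℂℝ^{n+1}; only the
radial integral with b = 2|a| remains. The power b^n cancels the factor 2^n of the density. -/
theorem integral_fiberIntegrand_one (ha : a ≠ 0) (hT0 : ∀ τ, T (τ, 0) = (τ / ‖a‖) • a) (τ : ℝ) :
    ∫ u, fiberIntegrand ψ a T 1 τ u = ψ (cplx ((τ / ‖a‖) • a, a)) *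
      (n.factorial * ballVol n / ((τ ^ 2 + ‖a‖ ^ 2) * ‖a‖ ^ n) : ℝ) := by
  have ha' : 0 < ‖a‖ := norm_pos_iff.2 ha
  have hs : hermSq (cplx ((τ / ‖a‖) • a, a)) = τ ^ 2 + ‖a‖ ^ 2 := by
    rw [hermSq_cplx, norm_smul, norm_div, norm_norm, div_mul_cancel₀ _ ha'.ne', Real.norm_eq_abs,
      sq_abs]
  have hpos : 0 < τ ^ 2 + ‖a‖ ^ 2 := by positivity
  simp only [fiberIntegrand, one_pow, sub_self, Real.sqrt_zero, zero_smul, hT0, hs]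
  rw [integral_const_mul, integral_complex_ofReal]
  congr 2
  simp only [fiberDensity]
  rw [integral_const_mul, integral_inv_sqrt_pow (by positivity) hpos]
  field_simp
  ring

variable {m M C : ℝ}

/-- A bound for the integrals over the slices, uniform in `κ`. -/
theorem integral_bound (hm : 0 < m) (ha : a ≠ 0) (τ : ℝ) :
    ∫ u : EuclideanSpace ℝ (Fin n),
      (Metric.closedBall (0 : EuclideanSpace ℝ (Fin (n + 1))) √M).indicator
      (fun _ => (Icc (-√M) √M).indicator (fun _ => C * (2 ^ n * n.factorial * M *
        (√(m ^ 2 + ‖a‖ ^ 2 * ‖u‖ ^ 2) ^ (n + 2))⁻¹)) τ) a =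
      (Icc (-√M) √M).indicator (fun _ =>
        (Metric.closedBall (0 : EuclideanSpace ℝ (Fin (n + 1))) √M).indicator
          (fun a => C * (2 ^ n * n.factorial * M) * ballVol n / m ^ 2 * (‖a‖ ^ n)⁻¹) a) τ := by
  have ha' : 0 < ‖a‖ := norm_pos_iff.2 ha
  by_cases h1 : a ∈ Metric.closedBall (0 : EuclideanSpace ℝ (Fin (n + 1))) √M <;>
  by_cases h2 : τ ∈ Icc (-√M) √M <;> simp only [h1, h2, indicator_of_mem, indicator_of_notMem,
    not_false_eq_true, integral_zero]
  rw [integral_const_mul, integral_const_mul, integral_inv_sqrt_pow ha' hm]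
  field_simp

theorem integrable_bound (hm : 0 < m) (ha : a ≠ 0) (τ : ℝ) :
    Integrable fun u : EuclideanSpace ℝ (Fin n) =>
      (Metric.closedBall (0 : EuclideanSpace ℝ (Fin (n + 1))) √M).indicator
      (fun _ => (Icc (-√M) √M).indicator (fun _ => C * (2 ^ n * n.factorial * M *
        (√(m ^ 2 + ‖a‖ ^ 2 * ‖u‖ ^ 2) ^ (n + 2))⁻¹)) τ) a := by
  have ha' : 0 < ‖a‖ := norm_pos_iff.2 ha
  by_cases h1 : a ∈ Metric.closedBall (0 : EuclideanSpace ℝ (Fin (n + 1))) √M <;>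
  by_cases h2 : τ ∈ Icc (-√M) √M <;> simp only [h1, h2, indicator_of_mem, indicator_of_notMem,
    not_false_eq_true]
  on_goal 1 => exact ((integrable_inv_sqrt_pow ha' hm).const_mul _).const_mul _
  all_goals exact integrable_zero _ _ _

theorem norm_integral_fiberIntegrand_le (hm : 0 < m) (hM : 0 < M) (hC : 0 < C)
    (hψC : ∀ ζ, ‖ψ ζ‖ ≤ C) (hψs : ∀ ζ, ψ ζ ≠ 0 → m ≤ hermSq ζ ∧ hermSq ζ ≤ M)
    (hTn : ∀ τ w, ‖T (τ, w)‖ ^ 2 = τ ^ 2 + ‖w‖ ^ 2) (ha : a ≠ 0) {κ : ℝ} (hκ : 1 / 2 ≤ κ) (τ : ℝ) :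
    ‖∫ u, fiberIntegrand ψ a T κ τ u‖ ≤ (Icc (-√M) √M).indicator (fun _ =>
        (Metric.closedBall (0 : EuclideanSpace ℝ (Fin (n + 1))) √M).indicator
          (fun a => C * (2 ^ n * n.factorial * M) * ballVol n / m ^ 2 * (‖a‖ ^ n)⁻¹) a) τ := by
  rw [← integral_bound hm ha]
  exact norm_integral_le_of_norm_le (integrable_bound hm ha τ)
    (.of_forall fun u => norm_fiberIntegrand_le hm hM hC hψC hψs hTn hκ τ u)

theorem norm_integral_slice_le (hψ : IsAdmissible ψ) (hm : 0 < m) (hM : 0 < M) (hC : 0 < C)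
    (hψC : ∀ ζ, ‖ψ ζ‖ ≤ C) (hψs : ∀ ζ, ψ ζ ≠ 0 → m ≤ hermSq ζ ∧ hermSq ζ ≤ M)
    (ha : a ≠ 0) {κ : ℝ} (hκ : 1 / 2 ≤ κ) (h1 : κ < 1) :
    ‖∫ y, ψ (cplx (y, a)) * (lieDensity κ n (cplx (y, a)) : ℂ)‖ ≤
      2 * √M * (Metric.closedBall (0 : EuclideanSpace ℝ (Fin (n + 1))) √M).indicator
          (fun a => C * (2 ^ n * n.factorial * M) * ballVol n / m ^ 2 * (‖a‖ ^ n)⁻¹) a := by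
  obtain ⟨T, hTm, hTc, hTn, hTa, hT0⟩ := exists_adapted_coordinates ha
  rw [integral_slice_eq hψ hTm hTn hTa (by linarith) h1]
  refine (norm_integral_le_of_norm_le ?_ (.of_forall fun τ =>
    norm_integral_fiberIntegrand_le hm hM hC hψC hψs hTn ha hκ τ)).trans_eq ?_
  · exact (integrable_indicator_iff measurableSet_Icc).2 (by simp)
  · rw [integral_indicator measurableSet_Icc, setIntegral_const, Measure.real, Real.volume_Icc,
      ENNReal.toReal_ofReal (by linarith [Real.sqrt_nonneg M]), smul_eq_mul]
    ring

theorem tendsto_integral_slice (hψ : IsAdmissible ψ) (ha : a ≠ 0) :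
    Tendsto (fun κ => ∫ y, ψ (cplx (y, a)) * (lieDensity κ n (cplx (y, a)) : ℂ)) (𝓝[<] 1)
      (𝓝 (∫ τ : ℝ, ψ (cplx ((τ / ‖a‖) • a, a)) *
        (n.factorial * ballVol n / ((τ ^ 2 + ‖a‖ ^ 2) * ‖a‖ ^ n) : ℝ))) := by
  obtain ⟨m, M, C, hm, hM, hC, hψC, hψs⟩ := hψ.exists_bounds
  obtain ⟨T, hTm, hTc, hTn, hTa, hT0⟩ := exists_adapted_coordinates ha
  have hev : ∀ᶠ κ : ℝ in 𝓝[<] 1, 1 / 2 ≤ κ ∧ κ < 1 := by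
    filter_upwards [Ioo_mem_nhdsLT (show (1 / 2 : ℝ) < 1 by norm_num)] with κ hκ using
      ⟨hκ.1.le, hκ.2⟩
  have hcont := continuous_fiberIntegrand hψ ha hTc
  simp_rw [← integral_fiberIntegrand_one (ψ := ψ) ha hT0]
  refine Tendsto.congr' (f₁ := fun κ => ∫ τ, ∫ u, fiberIntegrand ψ a T κ τ u) ?_ ?_
  · filter_upwards [hev] with κ hκ
    exact (integral_slice_eq hψ hTm hTn hTa (by linarith) hκ.2).symm
  refine tendsto_integral_filter_of_dominated_convergence _ ?_
    (hev.mono fun κ hκ => .of_forall fun τ =>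
      norm_integral_fiberIntegrand_le hm hM hC hψC hψs hTn ha hκ.1 τ) ?_ (.of_forall fun τ => ?_)
  · refine .of_forall fun κ => ?_
    have h : Continuous fun p : ℝ × EuclideanSpace ℝ (Fin n) => fiberIntegrand ψ a T κ p.1 p.2 :=
      hcont.comp (continuous_const.prodMk continuous_id)
    exact (h.stronglyMeasurable.integral_prod_right' (ν := volume)).aestronglyMeasurable
  · exact (integrable_indicator_iff measurableSet_Icc).2 (by simp)
  · refine tendsto_integral_filter_of_dominated_convergence _ ?_
      (hev.mono fun κ hκ => .of_forall fun u =>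
        norm_fiberIntegrand_le hm hM hC hψC hψs hTn hκ.1 τ u) (integrable_bound hm ha τ)
      (.of_forall fun u => ?_)
    · exact .of_forall fun κ => (hcont.comp (continuous_const.prodMk
        (continuous_const.prodMk continuous_id))).aestronglyMeasurable
    · have h : Continuous fun κ => fiberIntegrand ψ a T κ τ u :=
        hcont.comp (continuous_id.prodMk (continuous_const (y := (τ, u))))
      exact h.continuousAt.tendsto.mono_left nhdsWithin_le_nhds

/-- The singularity |a|^{-n} is cancelled by the polar weight r^n of ℝ^{n+1}. This makes the slice
bounds of `norm_integral_slice_le` integrable in a. -/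
theorem integrable_indicator_inv_norm_pow (r c : ℝ) :
    Integrable ((Metric.closedBall (0 : EuclideanSpace ℝ (Fin (n + 1))) r).indicator
      (fun a => c * (‖a‖ ^ n)⁻¹)) := by
  have h : IntegrableOn (fun a : EuclideanSpace ℝ (Fin (n + 1)) => (‖a‖ ^ n)⁻¹)
      (Metric.ball 0 (r + 1)) := by
    rw [integrableOn_fun_norm_addHaar volume (f := fun t => (t ^ n)⁻¹), finrank_euclideanSpace_fin]
    refine Integrable.mono' (g := fun _ => 1) (by simp) ?_ ?_
    · exact Measurable.aestronglyMeasurable (by fun_prop)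
    · filter_upwards [ae_restrict_mem measurableSet_Ioo] with t ht
      have : t ^ n ≠ 0 := pow_ne_zero _ ht.1.ne'
      simp [this]
  refine (integrable_indicator_iff Metric.isClosed_closedBall.measurableSet).2 ?_
  exact (h.mono_set (Metric.closedBall_subset_ball (by linarith))).const_mul c

theorem tendsto_integral_mul_lieDensity (hψ : IsAdmissible ψ) :
    Tendsto (fun κ => ∫ ζ, ψ ζ * (lieDensity κ n ζ : ℂ)) (𝓝[<] 1)
      (𝓝 (∫ a : EuclideanSpace ℝ (Fin (n + 1)), ∫ τ : ℝ, ψ (cplx ((τ / ‖a‖) • a, a)) *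
        (n.factorial * ballVol n / ((τ ^ 2 + ‖a‖ ^ 2) * ‖a‖ ^ n) : ℝ))) := by
  obtain ⟨m, M, C, hm, hM, hC, hψC, hψs⟩ := hψ.exists_bounds
  have hev : ∀ᶠ κ : ℝ in 𝓝[<] 1, 1 / 2 ≤ κ ∧ κ < 1 := by
    filter_upwards [Ioo_mem_nhdsLT (show (1 / 2 : ℝ) < 1 by norm_num)] with κ hκ using
      ⟨hκ.1.le, hκ.2⟩
  have hne : ∀ᵐ a : EuclideanSpace ℝ (Fin (n + 1)), a ≠ 0 :=
    compl_mem_ae_iff.2 (measure_singleton 0)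
  refine Tendsto.congr' (f₁ := fun κ => ∫ a, ∫ y,
    ψ (cplx (y, a)) * (lieDensity κ n (cplx (y, a)) : ℂ)) ?_ ?_
  · filter_upwards [hev] with κ hκ
    have hint := hψ.integrable_mul_lieDensity (show 0 ≤ κ by linarith) hκ.2
    obtain ⟨h1, h2⟩ := measurePreserving_cplx (N := n + 1)
    rw [← h1.integral_comp h2 (fun ζ => ψ ζ * (lieDensity κ n ζ : ℂ))]
    have hint' := (h1.integrable_comp_emb h2).2 hint
    rw [Measure.volume_eq_prod] at hint' ⊢
    exact (integral_prod_symm _ hint').symm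
  refine tendsto_integral_filter_of_dominated_convergence _ ?_
    (hev.mono fun κ hκ => hne.mono fun a ha =>
      norm_integral_slice_le hψ hm hM hC hψC hψs ha hκ.1 hκ.2) ?_
    (hne.mono fun a ha => tendsto_integral_slice hψ ha)
  · filter_upwards [hev] with κ hκ
    have h := (hψ.continuous_mul_lieDensity (show 0 ≤ κ by linarith) hκ.2).comp continuous_cplx
    exact (h.stronglyMeasurable.integral_prod_left' (μ := volume)).aestronglyMeasurable
  · exact (integrable_indicator_inv_norm_pow _ _).const_mul _

end Fiber
end LieMA

/-! ### Integration along ℂℝ^{n+1} in the coordinates (τ, a). -/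

namespace LieMA
open Complex Topology Filter MeasureTheory Set

section Polar

variable {n : ℕ} {ψ : (Fin (n + 1) → ℂ) → ℂ}

theorem hermSq_crParam {N : ℕ} (θ : ℝ) (a : EuclideanSpace ℝ (Fin N)) :
    hermSq (crParam θ a) = ‖a‖ ^ 2 := by
  simp [hermSq, crParam, EuclideanSpace.norm_sq_eq]

theorem continuous_crParam {N : ℕ} :
    Continuous fun p : ℝ × EuclideanSpace ℝ (Fin N) => crParam p.1 p.2 := by
  unfold crParam; fun_prop

theorem ballVol_nonneg (n : ℕ) : 0 ≤ ballVol n := ENNReal.toReal_nonneg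

/-- The orientation sign cancels the sign in C_n, so the current is a positive measure. -/
theorem crOrientation_mul (n : ℕ) (x : ℝ) :
    crOrientation n * (-constC n * x) = n.factorial * ballVol n * x := by
  rw [crOrientation, constC]
  rcases neg_one_pow_eq_or ℝ (n * (n - 1) / 2) with h | h <;> rw [h] <;> ring

/-- The integrand of the current of integration along `ℂℝ^{n+1}`. -/
noncomputable def crIntegrand (ψ : (Fin (n + 1) → ℂ) → ℂ) (θ : ℝ)
    (a : EuclideanSpace ℝ (Fin (n + 1))) : ℂ :=
  ψ (crParam θ a) * ((n.factorial * ballVol n * (‖a‖ ^ (n + 1))⁻¹ : ℝ) : ℂ)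

theorem crIntegrationCurrent_eq (ψ : (Fin (n + 1) → ℂ) → ℂ) :
    crIntegrationCurrent n (fun _ a => -constC n * (‖a‖ ^ (n + 1))⁻¹) ψ =
      ∫ p, crIntegrand ψ p.1 p.2 ∂((volume.restrict (Ioo 0 Real.pi)).prod volume) := by
  have : (volume.restrict (Ioo (0 : ℝ) Real.pi)).prod
      (volume : Measure (EuclideanSpace ℝ (Fin (n + 1)))) =
      volume.restrict (Ioo (0 : ℝ) Real.pi ×ˢ univ) := by
    rw [Measure.volume_eq_prod, ← Measure.prod_restrict, Measure.restrict_univ]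
  rw [this]
  simp only [crIntegrationCurrent, crOrientation_mul, crIntegrand]

theorem measurable_crIntegrand (hψ : IsAdmissible ψ) :
    Measurable fun p : ℝ × EuclideanSpace ℝ (Fin (n + 1)) => crIntegrand ψ p.1 p.2 := by
  refine ((hψ.continuous.comp continuous_crParam).measurable).mul ?_
  fun_prop

theorem integrable_crIntegrand (hψ : IsAdmissible ψ) :
    Integrable (fun p : ℝ × EuclideanSpace ℝ (Fin (n + 1)) => crIntegrand ψ p.1 p.2)
      ((volume.restrict (Ioo 0 Real.pi)).prod volume) := by
  obtain ⟨m, M, C, hm, hM, hC, hψC, hψs⟩ := hψ.exists_bounds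
  have hbd : Integrable ((Metric.closedBall (0 : EuclideanSpace ℝ (Fin (n + 1))) √M).indicator
      fun _ => C * (n.factorial * ballVol n * (√m ^ (n + 1))⁻¹)) :=
    (integrable_indicator_iff Metric.isClosed_closedBall.measurableSet).2
      (integrableOn_const (isCompact_closedBall _ _).measure_lt_top.ne)
  have hbd' := hbd.comp_snd (volume.restrict (Ioo 0 Real.pi))
  refine hbd'.mono' (measurable_crIntegrand hψ).aestronglyMeasurable (.of_forall fun p => ?_)
  have hb := ballVol_nonneg n
  by_cases h : ψ (crParam p.1 p.2) = 0
  · rw [crIntegrand, h, zero_mul, norm_zero]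
    exact indicator_nonneg (fun _ _ => by positivity) _
  obtain ⟨h1, h2⟩ := hψs _ h
  rw [hermSq_crParam] at h1 h2
  have h3 : √m ≤ ‖p.2‖ := Real.sqrt_le_iff.2 ⟨norm_nonneg _, h1⟩
  have h4 : 0 < √m := Real.sqrt_pos.2 hm
  rw [indicator_of_mem (by rw [mem_closedBall_zero_iff]; exact Real.le_sqrt_of_sq_le h2),
    crIntegrand, norm_mul, norm_real, Real.norm_of_nonneg (by positivity)]
  exact mul_le_mul (hψC _) (by gcongr) (by positivity) hC.le

/-- The integrand after the substitution `a ↦ a / sin θ`. -/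
theorem rescaled_crIntegrand {θ : ℝ} (hθ : θ ∈ Ioo 0 Real.pi)
    (a : EuclideanSpace ℝ (Fin (n + 1))) :
    ψ (crParam θ ((Real.sin θ)⁻¹ • a)) *
        ((n.factorial * ballVol n * (‖a‖ ^ (n + 1))⁻¹ : ℝ) : ℂ) =
      (Real.sin θ)⁻¹ ^ (n + 1) • crIntegrand ψ θ ((Real.sin θ)⁻¹ • a) := by
  have hs := Real.sin_pos_of_mem_Ioo hθ
  rw [crIntegrand, norm_smul, Real.norm_of_nonneg (by positivity), real_smul, mul_left_comm,
    ← ofReal_mul]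
  congr 2
  rw [mul_pow, mul_inv]
  field_simp

theorem measurable_rescaled_crIntegrand (hψ : IsAdmissible ψ) :
    Measurable fun p : ℝ × EuclideanSpace ℝ (Fin (n + 1)) =>
      ψ (crParam p.1 ((Real.sin p.1)⁻¹ • p.2)) *
        ((n.factorial * ballVol n * (‖p.2‖ ^ (n + 1))⁻¹ : ℝ) : ℂ) := by
  have hg : Measurable fun p : ℝ × EuclideanSpace ℝ (Fin (n + 1)) =>
      (p.1, (Real.sin p.1)⁻¹ • p.2) :=
    measurable_fst.prodMk ((Real.measurable_sin.comp measurable_fst).inv.smul measurable_snd)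
  have h1 := (hψ.continuous.comp (continuous_crParam (N := n + 1))).measurable.comp hg
  have h2 : Measurable fun p : ℝ × EuclideanSpace ℝ (Fin (n + 1)) =>
      ((n.factorial * ballVol n * (‖p.2‖ ^ (n + 1))⁻¹ : ℝ) : ℂ) := by fun_prop
  exact h1.mul h2

/-- Substitute τ = |a| cot θ: then e^{iθ}a/sin θ = (cot θ)a + ia, τ² + |a|² = |a|²/sin²θ and |dτ| =
|a| dθ/sin²θ. The cotangent appears as tan(π/2 - θ), a bijection of (0, π) onto ℝ. -/
theorem integral_cot_substitution {a : EuclideanSpace ℝ (Fin (n + 1))} (ha : a ≠ 0) :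
    ∫ θ in Ioo 0 Real.pi, ψ (crParam θ ((Real.sin θ)⁻¹ • a)) *
        ((n.factorial * ballVol n * (‖a‖ ^ (n + 1))⁻¹ : ℝ) : ℂ) =
      ∫ τ : ℝ, ψ (cplx ((τ / ‖a‖) • a, a)) *
        (n.factorial * ballVol n / ((τ ^ 2 + ‖a‖ ^ 2) * ‖a‖ ^ n) : ℝ) := by
  have ha' : 0 < ‖a‖ := norm_pos_iff.2 ha
  have hmem : ∀ θ ∈ Ioo 0 Real.pi, Real.pi / 2 - θ ∈ Ioo (-(Real.pi / 2)) (Real.pi / 2) :=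
    fun θ hθ => ⟨by linarith [hθ.2], by linarith [hθ.1]⟩
  have himg : (fun θ => ‖a‖ * Real.tan (Real.pi / 2 - θ)) '' Ioo 0 Real.pi = univ := by
    refine eq_univ_of_forall fun t => ⟨Real.pi / 2 - Real.arctan (t / ‖a‖), ⟨?_, ?_⟩, ?_⟩
    · linarith [Real.arctan_lt_pi_div_two (t / ‖a‖)]
    · linarith [Real.neg_pi_div_two_lt_arctan (t / ‖a‖)]
    · simp only [sub_sub_cancel, Real.tan_arctan]
      field_simp
  have hderiv : ∀ θ ∈ Ioo 0 Real.pi, HasDerivWithinAt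
      (fun θ => ‖a‖ * Real.tan (Real.pi / 2 - θ)) (‖a‖ * (1 / Real.sin θ ^ 2 * -1))
      (Ioo 0 Real.pi) θ := by
    intro θ hθ
    have h1 := Real.hasDerivAt_tan (Real.cos_pos_of_mem_Ioo (hmem θ hθ)).ne'
    rw [Real.cos_pi_div_two_sub] at h1
    have h2 : HasDerivAt (fun θ : ℝ => Real.pi / 2 - θ) (-1) θ := (hasDerivAt_id θ).const_sub _
    exact ((h1.comp θ h2).const_mul _).hasDerivWithinAt
  have hinj : InjOn (fun θ => ‖a‖ * Real.tan (Real.pi / 2 - θ)) (Ioo 0 Real.pi) := by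
    intro x hx y hy hxy
    have := Real.injOn_tan (hmem x hx) (hmem y hy) (mul_left_cancel₀ ha'.ne' hxy)
    linarith
  rw [← setIntegral_univ (f := fun τ : ℝ => ψ (cplx ((τ / ‖a‖) • a, a)) *
    (n.factorial * ballVol n / ((τ ^ 2 + ‖a‖ ^ 2) * ‖a‖ ^ n) : ℝ)), ← himg,
    integral_image_eq_integral_abs_deriv_smul measurableSet_Ioo hderiv hinj]
  refine setIntegral_congr_fun measurableSet_Ioo fun θ hθ => ?_
  have hs := Real.sin_pos_of_mem_Ioo hθ
  have htan : Real.tan (Real.pi / 2 - θ) = Real.cos θ / Real.sin θ := by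
    rw [Real.tan_eq_sin_div_cos, Real.sin_pi_div_two_sub, Real.cos_pi_div_two_sub]
  have hpt : crParam θ ((Real.sin θ)⁻¹ • a) =
      cplx ((‖a‖ * (Real.cos θ / Real.sin θ) / ‖a‖) • a, a) := by
    funext j
    have hs' : (Real.sin θ : ℂ) ≠ 0 := ofReal_ne_zero.2 hs.ne'
    have ha2 : ((‖a‖ : ℝ) : ℂ) ≠ 0 := ofReal_ne_zero.2 ha'.ne'
    simp only [crParam, cplx, PiLp.smul_apply, smul_eq_mul]
    rw [exp_mul_I, ← ofReal_cos, ← ofReal_sin]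
    push_cast
    rw [← ofReal_cos, ← ofReal_sin]
    field_simp
  simp only [htan]
  rw [hpt, real_smul, mul_left_comm, ← ofReal_mul]
  congr 2
  rw [abs_of_neg (by have : 0 < ‖a‖ / Real.sin θ ^ 2 := by positivity
                     have e : ‖a‖ * (1 / Real.sin θ ^ 2 * -1) = -(‖a‖ / Real.sin θ ^ 2) := by ring
                     rw [e]; linarith)]
  have h1 : (‖a‖ * (Real.cos θ / Real.sin θ)) ^ 2 + ‖a‖ ^ 2 = ‖a‖ ^ 2 / Real.sin θ ^ 2 := by
    have := Real.sin_sq_add_cos_sq θ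
    field_simp
    linarith
  rw [h1]
  field_simp
  ring

/-- For each θ in (0, π), the dilation a ↦ a/sin θ normalizes the imaginary part of e^{iθ}a to a.
Fubini's theorem then allows the cotangent substitution for fixed a. -/
theorem crIntegrationCurrent_eq_integral (hψ : IsAdmissible ψ) :
    crIntegrationCurrent n (fun _ a => -constC n * (‖a‖ ^ (n + 1))⁻¹) ψ =
      ∫ a : EuclideanSpace ℝ (Fin (n + 1)), ∫ τ : ℝ, ψ (cplx ((τ / ‖a‖) • a, a)) *
        (n.factorial * ballVol n / ((τ ^ 2 + ‖a‖ ^ 2) * ‖a‖ ^ n) : ℝ) := by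
  have hq := integrable_crIntegrand hψ
  set μ := volume.restrict (Ioo (0 : ℝ) Real.pi) with hμ
  have hμmem : ∀ᵐ θ ∂μ, θ ∈ Ioo (0 : ℝ) Real.pi := ae_restrict_mem measurableSet_Ioo
  let q' : ℝ × EuclideanSpace ℝ (Fin (n + 1)) → ℂ := fun p =>
    ψ (crParam p.1 ((Real.sin p.1)⁻¹ • p.2)) *
      ((n.factorial * ballVol n * (‖p.2‖ ^ (n + 1))⁻¹ : ℝ) : ℂ)
  -- The target F is arbitrary because the identity is used for the complex integrand and for its
  -- norm.
  have hscale : ∀ θ ∈ Ioo (0 : ℝ) Real.pi, ∀ {F : Type} [NormedAddCommGroup F] [NormedSpace ℝ F]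
      (f : EuclideanSpace ℝ (Fin (n + 1)) → F),
      ∫ a, (Real.sin θ)⁻¹ ^ (n + 1) • f ((Real.sin θ)⁻¹ • a) = ∫ a, f a := by
    intro θ hθ F _ _ f
    have hs := Real.sin_pos_of_mem_Ioo hθ
    rw [integral_smul, Measure.integral_comp_smul volume f, finrank_euclideanSpace_fin,
      abs_of_pos (by positivity), smul_smul, mul_inv_cancel₀ (by positivity), one_smul]
  have hq'meas : Measurable q' := measurable_rescaled_crIntegrand hψ
  -- Dilation preserves integrability and the norm integral on each θ-slice, so q' inherits
  -- integrability from the original integrand.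
  have hq' : Integrable q' (μ.prod volume) := by
    refine (integrable_prod_iff hq'meas.aestronglyMeasurable).2 ⟨?_, ?_⟩
    · filter_upwards [hμmem, hq.prod_right_ae] with θ hθ hint
      have hs := Real.sin_pos_of_mem_Ioo hθ
      simp only [q', rescaled_crIntegrand hθ]
      exact (hint.comp_smul (inv_ne_zero hs.ne')).smul ((Real.sin θ)⁻¹ ^ (n + 1))
    · refine hq.integral_norm_prod_left.congr ?_
      filter_upwards [hμmem] with θ hθ
      have hs := Real.sin_pos_of_mem_Ioo hθ
      rw [← hscale θ hθ]
      congr 1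
      funext a
      simp only [q', rescaled_crIntegrand hθ]
      rw [norm_smul, Real.norm_of_nonneg (by positivity), smul_eq_mul]
  have hne : ∀ᵐ a : EuclideanSpace ℝ (Fin (n + 1)), a ≠ 0 :=
    compl_mem_ae_iff.2 (measure_singleton 0)
  calc _ = ∫ θ, ∫ a, crIntegrand ψ θ a ∂volume ∂μ := by
        rw [crIntegrationCurrent_eq, integral_prod _ hq]
    _ = ∫ θ, ∫ a, q' (θ, a) ∂volume ∂μ := by
        refine integral_congr_ae ?_
        filter_upwards [hμmem] with θ hθ
        rw [← hscale θ hθ]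
        simp only [q', rescaled_crIntegrand hθ]
    _ = ∫ a, ∫ θ, q' (θ, a) ∂μ ∂volume := by
        rw [← integral_prod _ hq', integral_prod_symm _ hq']
    _ = _ := by
        refine integral_congr_ae ?_
        filter_upwards [hne] with a ha using integral_cot_substitution ha

/-- The measures with densities `lieDensity κ n` converge weakly on `ℂ^{n+1} ∖ {0}`. -/
theorem tendsto_integral_mul_lieDensity_crIntegrationCurrent (hψ : IsAdmissible ψ) :
    Tendsto (fun κ => ∫ ζ, ψ ζ * (lieDensity κ n ζ : ℂ)) (𝓝[<] 1)
      (𝓝 (crIntegrationCurrent n (fun _ a => -constC n * (‖a‖ ^ (n + 1))⁻¹) ψ)) := by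
  rw [crIntegrationCurrent_eq_integral hψ]
  exact tendsto_integral_mul_lieDensity hψ

theorem crIntegrationCurrent_sum {ι : Type*} (s : Finset ι) {ψ : ι → (Fin (n + 1) → ℂ) → ℂ}
    (hψ : ∀ i ∈ s, IsAdmissible (ψ i)) :
    crIntegrationCurrent n (fun _ a => -constC n * (‖a‖ ^ (n + 1))⁻¹) (fun ζ => ∑ i ∈ s, ψ i ζ) =
      ∑ i ∈ s, crIntegrationCurrent n (fun _ a => -constC n * (‖a‖ ^ (n + 1))⁻¹) (ψ i) := by
  simp only [crIntegrationCurrent_eq]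
  rw [← integral_finsetSum s fun i hi => integrable_crIntegrand (hψ i hi)]
  simp only [crIntegrand, Finset.sum_mul]

end Polar
end LieMA

/-! ### Direct images and the change of variables under Φ̃. -/

namespace LieMA
open Complex Topology Filter MeasureTheory Set

section DirectImage

variable {m : ℕ} {F : (Fin m → ℂ) → (Fin m → ℂ)} {W : Set (Fin m → ℂ)}
  {χ : (Fin m → ℂ) → ℂ} {e : OpenPartialHomeomorph (Fin m → ℂ) (Fin m → ℂ)}

theorem eq_symm_of_finsum_ne_zero (he : ⇑e = F) (hχe : tsupport χ ⊆ e.source) {w ζ : Fin m → ℂ}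
    (h : (∑ᶠ (_ : w ∈ W ∧ F w = ζ), χ w) ≠ 0) : ζ ∈ e.target ∧ w = e.symm ζ := by
  by_cases hp : w ∈ W ∧ F w = ζ
  · simp only [hp, and_self, finsum_true] at h
    have hw : w ∈ e.source := hχe (subset_tsupport _ h)
    rw [← hp.2, ← he]
    exact ⟨e.map_source hw, (e.left_inv hw).symm⟩
  · simp [hp] at h

theorem directImage_of_mem_target (he : ⇑e = F) (hχe : tsupport χ ⊆ e.source)
    (hχW : tsupport χ ⊆ W) {ζ : Fin m → ℂ} (hζ : ζ ∈ e.target) :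
    directImage F W χ ζ = χ (e.symm ζ) := by
  rw [directImage, finsum_eq_single _ (e.symm ζ) fun w hw => by
    by_contra h
    exact hw (eq_symm_of_finsum_ne_zero he hχe h).2]
  have hF : F (e.symm ζ) = ζ := by rw [← he]; exact e.right_inv hζ
  by_cases hW : e.symm ζ ∈ W
  · simp [hW, hF]
  · have : χ (e.symm ζ) = 0 := image_eq_zero_of_notMem_tsupport fun h => hW (hχW h)
    simp [hW, this]

theorem directImage_eq_zero (he : ⇑e = F) (hχe : tsupport χ ⊆ e.source)
    (hχW : tsupport χ ⊆ W) {ζ : Fin m → ℂ} (hζ : ζ ∉ F '' tsupport χ) :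
    directImage F W χ ζ = 0 := by
  by_cases ht : ζ ∈ e.target
  · rw [directImage_of_mem_target he hχe hχW ht]
    refine image_eq_zero_of_notMem_tsupport fun h => hζ ⟨_, h, ?_⟩
    rw [← he]
    exact e.right_inv ht
  · rw [directImage]
    refine (finsum_congr fun w => ?_).trans finsum_zero
    by_contra h
    exact ht (eq_symm_of_finsum_ne_zero he hχe h).1

/-- Additivity of a `finsum` needs finite supports; here each χ_i meets a fibre of F in at most one
point, by injectivity on the source of e_i. -/
theorem directImage_sum {ι : Type*} (s : Finset ι) {χ : ι → (Fin m → ℂ) → ℂ}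
    {e : ι → OpenPartialHomeomorph (Fin m → ℂ) (Fin m → ℂ)} (he : ∀ i, ⇑(e i) = F)
    (hχe : ∀ i, tsupport (χ i) ⊆ (e i).source) (ζ : Fin m → ℂ) :
    directImage F W (fun w => ∑ i ∈ s, χ i w) ζ = ∑ i ∈ s, directImage F W (χ i) ζ := by
  simp only [directImage]
  rw [← finsum_sum_comm]
  · refine finsum_congr fun w => ?_
    by_cases hp : w ∈ W ∧ F w = ζ
    · simp [hp]
    · simp [hp]
  · intro i _
    exact (finite_singleton ((e i).symm ζ)).subset fun w hw =>
      (eq_symm_of_finsum_ne_zero (he i) (hχe i) hw).2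

/-- The direct image is χ ∘ e⁻¹ on the open target and 0 off the compact set F(supp χ). These open
sets cover the space, so the extension by zero is continuous. -/
theorem isAdmissible_directImage (he : ⇑e = F) (hχ : Continuous χ) (hχc : HasCompactSupport χ)
    (hχe : tsupport χ ⊆ e.source) (hχW : tsupport χ ⊆ W) (hF0 : ∀ w ∈ tsupport χ, F w ≠ 0) :
    IsAdmissible (directImage F W χ) := by
  have hFc : ContinuousOn F (tsupport χ) := he ▸ e.continuousOn.mono hχe
  have hK : IsCompact (F '' tsupport χ) := IsCompact.image_of_continuousOn hχc hFc
  have hKt : F '' tsupport χ ⊆ e.target := by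
    rintro _ ⟨w, hw, rfl⟩
    rw [← he]
    exact e.map_source (hχe hw)
  have hts : tsupport (directImage F W χ) ⊆ F '' tsupport χ := by
    refine closure_minimal (fun ζ hζ => ?_) hK.isClosed
    by_contra h
    exact hζ (directImage_eq_zero he hχe hχW h)
  refine ⟨continuous_iff_continuousAt.2 fun ζ => ?_, hK.of_isClosed_subset isClosed_closure hts,
    fun h => ?_⟩
  · by_cases hζ : ζ ∈ e.target
    · have h1 : ContinuousAt (fun ζ => χ (e.symm ζ)) ζ :=
        hχ.continuousAt.comp (e.continuousAt_symm hζ)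
      refine h1.congr ?_
      filter_upwards [e.open_target.mem_nhds hζ] with x hx
      exact (directImage_of_mem_target he hχe hχW hx).symm
    · refine (continuousAt_const (y := (0 : ℂ))).congr ?_
      filter_upwards [hK.isClosed.isOpen_compl.mem_nhds fun h => hζ (hKt h)] with x hx
      exact (directImage_eq_zero he hχe hχW hx).symm
  · obtain ⟨w, hw, h0⟩ := hts h
    exact hF0 w hw h0

/-- The real determinant is the norm from ℂ to ℝ of the complex one. -/
theorem abs_det_restrictScalars (A : (Fin m → ℂ) →L[ℂ] (Fin m → ℂ)) :
    |(A.restrictScalars ℝ).det| = ‖A.det‖ ^ 2 := by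
  have : (A.restrictScalars ℝ).det =
      LinearMap.det ((A : (Fin m → ℂ) →ₗ[ℂ] (Fin m → ℂ)).restrictScalars ℝ) := rfl
  rw [this, LinearMap.det_restrictScalars, Algebra.norm_complex_eq]
  change |normSq A.det| = _
  rw [normSq_eq_norm_sq, abs_of_nonneg (sq_nonneg _)]

/-- The change of variables for a holomorphic map that is injective near the support of `χ`. -/
theorem integral_directImage_mul (he : ⇑e = F) (hχe : tsupport χ ⊆ e.source)
    (hχW : tsupport χ ⊆ W) {V : Set (Fin m → ℂ)} (hV : IsOpen V) (hF : DifferentiableOn ℂ F V)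
    (hχV : tsupport χ ⊆ V) {g : (Fin m → ℂ) → ℂ} {G : (Fin m → ℂ) → ℂ}
    (hG : ∀ z ∈ V, G z = (‖(fderiv ℂ F z).det‖ ^ 2 : ℝ) * g (F z))
    (hint : Integrable fun ζ => directImage F W χ ζ * g ζ) :
    Integrable (fun z => χ z * G z) ∧
      ∫ z, χ z * G z = ∫ ζ, directImage F W χ ζ * g ζ := by
  set S := e.source ∩ V
  have hS : MeasurableSet S := (e.open_source.inter hV).measurableSet
  have hχS : tsupport χ ⊆ S := subset_inter hχe hχV
  have hd : ∀ z ∈ S, HasFDerivWithinAt F ((fderiv ℂ F z).restrictScalars ℝ) S z := fun z hz =>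
    ((hF.differentiableAt (hV.mem_nhds hz.2)).hasFDerivAt.restrictScalars ℝ).hasFDerivWithinAt
  have hinj : InjOn F S := he ▸ e.injOn.mono inter_subset_left
  have heq : ∀ z ∈ S, |((fderiv ℂ F z).restrictScalars ℝ).det| •
      (directImage F W χ (F z) * g (F z)) = χ z * G z := by
    intro z hz
    have : F z ∈ e.target := by rw [← he]; exact e.map_source hz.1
    rw [directImage_of_mem_target he hχe hχW this, abs_det_restrictScalars, hG z hz.2, ← he,
      e.left_inv hz.1, real_smul]
    ring
  have hz1 : ∀ z ∉ S, χ z * G z = 0 := fun z hz => by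
    rw [image_eq_zero_of_notMem_tsupport fun h => hz (hχS h), zero_mul]
  have hz2 : ∀ ζ ∉ F '' S, directImage F W χ ζ * g ζ = 0 := fun ζ hζ => by
    rw [directImage_eq_zero he hχe hχW fun h => hζ (image_mono hχS h), zero_mul]
  constructor
  · have h1 := (integrableOn_image_iff_integrableOn_abs_det_fderiv_smul volume hS hd hinj
      (fun ζ => directImage F W χ ζ * g ζ)).1 hint.integrableOn
    have h2 := h1.congr_fun heq hS
    exact (integrableOn_iff_integrable_of_support_subset fun z hz => by
      by_contra h; exact hz (hz1 z h)).1 h2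
  · rw [← setIntegral_eq_integral_of_forall_compl_eq_zero hz1,
      ← setIntegral_eq_integral_of_forall_compl_eq_zero hz2,
      integral_image_eq_integral_abs_det_fderiv_smul volume hS hd hinj]
    exact (setIntegral_congr_fun hS heq).symm

end DirectImage

/-! ### Local inverses, the partition of χ, and the conclusion. -/

section Main

variable {n : ℕ} {Φ : (Fin n → ℂ) → (Fin (n + 1) → ℂ)}

theorem exists_local_inverse (hΦ : DifferentiableOn ℂ Φ (polydisc n)) {w : Fin (n + 1) → ℂ}
    (hw : w ∈ regularSet Φ) :
    ∃ e : OpenPartialHomeomorph (Fin (n + 1) → ℂ) (Fin (n + 1) → ℂ),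
      ⇑e = tildeMap Φ ∧ w ∈ e.source := by
  have hs := hasStrictFDerivAt_of_differentiableOn (isOpen_polydisc _)
    (differentiableOn_tildeMap hΦ) hw.1
  have hs' : HasStrictFDerivAt (tildeMap Φ)
      (((fderiv ℂ (tildeMap Φ) w).toContinuousLinearEquivOfDetNeZero hw.2 :
        (Fin (n + 1) → ℂ) ≃L[ℂ] (Fin (n + 1) → ℂ)) : (Fin (n + 1) → ℂ) →L[ℂ] _) w := by
    rwa [ContinuousLinearMap.coe_toContinuousLinearEquivOfDetNeZero]
  exact ⟨hs'.toOpenPartialHomeomorph _, hs'.toOpenPartialHomeomorph_coe,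
    hs'.mem_toOpenPartialHomeomorph_source⟩

/-- The limit is taken from the left because the density lemmas need κ < 1. -/
theorem tendsto_kappa :
    Tendsto (fun ε : ℝ => (1 - ε) / (1 + ε)) (𝓝[>] 0) (𝓝[<] 1) := by
  refine tendsto_nhdsWithin_iff.2 ⟨?_, ?_⟩
  · have : ContinuousAt (fun ε : ℝ => (1 - ε) / (1 + ε)) 0 :=
      ContinuousAt.div (by fun_prop) (by fun_prop) (by norm_num)
    have h := this.tendsto.mono_left (nhdsWithin_le_nhds (s := Ioi 0))
    simpa using h
  · filter_upwards [Ioo_mem_nhdsGT (show (0 : ℝ) < 1 by norm_num)] with ε hε using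
      (kappa_mem hε.1 hε.2).2

/-- A finite continuous partition of a compactly supported function, subordinate to the domains of
injectivity of a locally injective map. -/
theorem exists_partition {m : ℕ} {F : (Fin m → ℂ) → (Fin m → ℂ)} {χ : (Fin m → ℂ) → ℂ}
    (hχ : Continuous χ) (hχc : HasCompactSupport χ)
    (hF : ∀ w ∈ tsupport χ, ∃ e : OpenPartialHomeomorph (Fin m → ℂ) (Fin m → ℂ),
      ⇑e = F ∧ w ∈ e.source) :
    ∃ (k : ℕ) (e : Fin k → OpenPartialHomeomorph (Fin m → ℂ) (Fin m → ℂ))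
      (η : Fin k → (Fin m → ℂ) → ℂ), (∀ i, ⇑(e i) = F) ∧ (∀ i, Continuous (η i)) ∧
      (∀ i, HasCompactSupport (η i)) ∧ (∀ i, tsupport (η i) ⊆ (e i).source) ∧
      (∀ i, tsupport (η i) ⊆ tsupport χ) ∧ χ = fun w => ∑ i, η i w := by
  have : Nonempty (OpenPartialHomeomorph (Fin m → ℂ) (Fin m → ℂ)) := ⟨.refl _⟩
  choose! e he hw using hF
  obtain ⟨t, ht, hcov⟩ := IsCompact.elim_nhds_subcover hχc (fun w => (e w).source) fun w hwm =>
    (e w).open_source.mem_nhds (hw w hwm)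
  let c : Fin t.card → Fin m → ℂ := fun i => t.equivFin.symm i
  have hcm : ∀ i, c i ∈ tsupport χ := fun i => ht _ (t.equivFin.symm i).2
  obtain ⟨f, hf1, hf2, -, -⟩ := exists_continuous_sum_one_of_isOpen_isCompact
    (s := fun i => (e (c i)).source) (fun i => (e (c i)).open_source) hχc (fun w hwm => by
      obtain ⟨x, hx, hx'⟩ := mem_iUnion₂.1 (hcov hwm)
      refine mem_iUnion.2 ⟨t.equivFin ⟨x, hx⟩, ?_⟩
      simpa [c] using hx')
  have hη : ∀ i, Continuous fun w => ((f i w : ℝ) : ℂ) * χ w := fun i =>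
    (continuous_ofReal.comp (f i).continuous).mul hχ
  refine ⟨t.card, fun i => e (c i), fun i w => ((f i w : ℝ) : ℂ) * χ w, fun i => he _ (hcm i), hη,
    fun i => hχc.mul_left, fun i => ?_, fun i => ?_, ?_⟩
  · refine Subset.trans (closure_mono fun w hw' => ?_) (hf1 i)
    exact ofReal_ne_zero.1 (left_ne_zero_of_mul hw')
  · exact closure_mono fun w hw' => right_ne_zero_of_mul hw'
  · funext w
    rw [← Finset.sum_mul]
    by_cases hwm : w ∈ tsupport χ
    · have := hf2 hwm
      simp only [Finset.sum_apply, Pi.one_apply] at this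
      rw [← ofReal_sum, this]
      simp
    · rw [image_eq_zero_of_notMem_tsupport hwm, mul_zero]

end Main
end LieMA

theorem theorem7p3 (n : ℕ) (Φ : (Fin n → ℂ) → (Fin (n + 1) → ℂ))
    (hΦ : DifferentiableOn ℂ Φ (LieMA.polydisc n))
    (hΦ0 : ∀ z ∈ LieMA.polydisc n, Φ z ≠ 0)
    (χ : (Fin (n + 1) → ℂ) → ℂ) (hχ : LieMA.IsTestFunction (LieMA.regularSet Φ) χ) :
    Filter.Tendsto
      (fun ε : ℝ => LieMA.mongeAmpereWedge (fun z => LieMA.hReg ε (Φ z)) χ)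
      (nhdsWithin 0 (Set.Ioi 0))
      (nhds (LieMA.pullbackCurrent (LieMA.tildeMap Φ) (LieMA.regularSet Φ)
        (LieMA.crIntegrationCurrent n
          (fun _ a => -LieMA.constC n * (‖a‖ ^ (n + 1))⁻¹)) χ)) := by
  obtain ⟨hχs, hχc, hχW⟩ := hχ
  obtain ⟨k, e, η, he, hη, hηc, hηe, hηχ, hsum⟩ := LieMA.exists_partition hχs.continuous hχc
    fun w hw => LieMA.exists_local_inverse hΦ (hχW hw)
  have hηW : ∀ i, tsupport (η i) ⊆ LieMA.regularSet Φ := fun i => (hηχ i).trans hχW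
  have hηV : ∀ i, tsupport (η i) ⊆ LieMA.polydisc (n + 1) := fun i w hw => (hηW i hw).1
  have hadm : ∀ i, LieMA.IsAdmissible
      (LieMA.directImage (LieMA.tildeMap Φ) (LieMA.regularSet Φ) (η i)) := fun i =>
    LieMA.isAdmissible_directImage (he i) (hη i) (hηc i) (hηe i) (hηW i) fun w hw =>
      LieMA.tildeMap_ne_zero hΦ0 (hηV i hw)
  -- Both sides are linear in χ, but the integral is split only after the direct images of the
  -- pieces are known to be admissible, hence integrable against the limit.
  have hlim : LieMA.pullbackCurrent (LieMA.tildeMap Φ) (LieMA.regularSet Φ)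
      (LieMA.crIntegrationCurrent n (fun _ a => -LieMA.constC n * (‖a‖ ^ (n + 1))⁻¹)) χ =
      ∑ i, LieMA.crIntegrationCurrent n (fun _ a => -LieMA.constC n * (‖a‖ ^ (n + 1))⁻¹)
        (LieMA.directImage (LieMA.tildeMap Φ) (LieMA.regularSet Φ) (η i)) := by
    rw [LieMA.pullbackCurrent, ← LieMA.crIntegrationCurrent_sum _ fun i _ => hadm i, hsum]
    congr 1
    funext ζ
    exact LieMA.directImage_sum _ he hηe ζ
  rw [hlim]
  refine Filter.Tendsto.congr' (f₁ := fun ε : ℝ => ∑ i, ∫ ζ,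
    LieMA.directImage (LieMA.tildeMap Φ) (LieMA.regularSet Φ) (η i) ζ *
      (LieMA.lieDensity ((1 - ε) / (1 + ε)) n ζ : ℂ)) ?_ ?_
  · filter_upwards [Ioo_mem_nhdsGT (show (0 : ℝ) < 1 by norm_num)] with ε hε
    obtain ⟨h0, h1⟩ := LieMA.kappa_mem hε.1 hε.2
    -- For 0 < ε < 1 each piece is an exact change of variables to the measure with density
    -- `lieDensity`; the limit then concerns only that measure.
    have key := fun i => LieMA.integral_directImage_mul (he i) (hηe i) (hηW i)
      (LieMA.isOpen_polydisc (n + 1)) (LieMA.differentiableOn_tildeMap hΦ) (hηV i)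
      (g := fun ζ => (LieMA.lieDensity ((1 - ε) / (1 + ε)) n ζ : ℂ))
      (G := fun z => LieMA.mongeAmpere (fun z => LieMA.hReg ε (Φ z)) (fun j => z j.castSucc) /
        ((‖1 + z (Fin.last n)‖ ^ 2 : ℝ) : ℂ))
      (fun z hz => by rw [LieMA.mongeAmpere_div_eq hΦ hΦ0 hz hε.1 hε.2, Complex.ofReal_mul])
      ((hadm i).integrable_mul_lieDensity h0 h1)
    rw [LieMA.mongeAmpereWedge, hsum]
    simp only [Finset.sum_mul]
    rw [MeasureTheory.integral_finsetSum _ fun i _ => (key i).1]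
    exact Finset.sum_congr rfl fun i _ => (key i).2.symm
  · exact tendsto_finsetSum _ fun i _ =>
      (LieMA.tendsto_integral_mul_lieDensity_crIntegrationCurrent (hadm i)).comp
        LieMA.tendsto_kappa
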